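/- Fix integers $2\le k'<k$. **Setting.** For an integer $K\ge 2$, the growing sequence of $K$-ary trees $(T_n(K),n\ge 0)$ is the following random sequence of finite rooted trees with labelled edges (considered up to label-preserving isomorphism of rooted trees). $T_0(K)$ is the tree with one edge and two vertices, a root and a leaf; the edge adjacent to the root never carries a label. Given $T_0(K),\dots,T_n(K)$, choose uniformly at random one of the $Kn+1$ edges of $T_n(K)$, split it into two edges by a new vertex, and graft $K-1$ new edges, each ending in a leaf, on this vertex; the part of the split edge towards the root keeps the label of the split edge (no label if it is adjacent to the root), the part away from the root gets the label $1$, and the new edges get the labels $2,\dots,K$. The resulting tree is $T_{n+1}(K)$. Let $T_n(k,k')$ be the subtree of $T_n(k)$ obtained by discarding all the edges with label at least $k'+1$ as well as their descendants, and let $I_n$ be the number of internal nodes of $T_n(k)$ (vertices that are neither the root nor leaves) which belong to $T_n(k,k')$. For $\alpha\in(0,1)$ and $\theta>-\alpha$, an $(\alpha,\theta)$-generalized Mittag-Leffler random variable is a nonnegative random variable $M_{\alpha,\theta}$ whose law is characterized by its moments $$\mathbb E\big[M_{\alpha,\theta}^{q}\big]=\frac{\Gamma(\theta+1)\,\Gamma(\theta/\alpha+q+1)}{\Gamma(\theta/\alpha+1)\,\Gamma(\theta+q\alpha+1)},\qquad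 q\ge 0 .$$ **Lemma.** On the probability space on which $(T_n(k),n\ge0)$ is defined: 1. There exists a sequence $(\tilde T_i(k'),i\ge 0)$, distributed as $(T_i(k'),i\ge0)$ and independent of $(I_n,n\ge 0)$, such that almost surely $$T_n(k,k')=\tilde T_{I_n}(k')\qquad\text{for all } n\ge 0 .$$ 2. $(I_n,n\ge0)$ is a (time-inhomogeneous) Markov chain started from $I_0=0$, with transition probabilities $$\mathbb P(I_{n+1}=i+1\mid I_n=i)=1-\mathbb P(I_{n+1}=i\mid I_n=i)=\frac{k'i+1}{kn+1}.$$ 3. As $n\to\infty$, $I_n/n^{k'/k}$ converges almost surely to a random variable which has the $(k'/k,1/k)$-generalized Mittag-Leffler distribution. -/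

import Mathlib

open MeasureTheory ProbabilityTheory Filter Topology

noncomputable section

/-- A finite rooted tree with labelled edges, whose root is adjacent to a single unlabelled edge, and
in which the edges leaving a vertex other than the root upwards carry distinct labels, considered up
to label-preserving isomorphism. It is the finite set of its edges, an edge being written as the word
of the labels met on the path that leads from the root to it, its own label included. So the edge
adjacent to the root is the empty word, and `w ++ [i]` is the edge labelled `i` that leaves the upper
end of the edge `w`. The vertices other than the root are identified with the edges below them. The σ-algebra is Mathlib's
one on `Finset (List ℕ)`, which is discrete since this type is countable. -/
abbrev EdgeTree : Type := Finset (List ℕ)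

namespace EdgeTree

/-- The tree with one edge and two vertices: one root, one leaf. -/
def single : EdgeTree := {[]}

/-- Split the edge `w` of `t` by a new vertex, and graft `k - 1` new edges on this vertex. The lower
half of the split edge keeps the label of `w` (it is the word `w`), the upper half gets the label `1`
(so that the edges above `w` acquire a label `1` just after `w`), the new edges get the labels
`2, …, k`. The edges that are not above `w` are unchanged. -/
def graft (k : ℕ) (t : EdgeTree) (w : List ℕ) : EdgeTree :=
  t.filter (fun v => ¬ w <+: v) ∪ {w}
    ∪ (t.filter (fun v => w <+: v)).image (fun v => w ++ 1 :: v.drop w.length)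
    ∪ (Finset.Icc 2 k).image (fun i => w ++ [i])

/-- Probability to obtain `t'` from `t` by grafting on an edge of `t` chosen uniformly at random. -/
def growthProb (k : ℕ) (t t' : EdgeTree) : ℝ :=
  ((t.filter (fun w => graft k t w = t')).card : ℝ) / (t.card : ℝ)

/-- The subtree obtained by discarding all the edges with label at least `k' + 1`, as well as their
descendants. -/
def subtree (k' : ℕ) (t : EdgeTree) : EdgeTree :=
  t.filter (fun w => ∀ i ∈ w, i ≤ k')

/-- The internal nodes: the vertices other than the root that have descendants. -/
def internalNodes (t : EdgeTree) : Finset (List ℕ) :=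
  t.filter (fun w => ∃ v ∈ t, w <+: v ∧ w ≠ v)

/-- The number of internal nodes of `t` which are in its subtree `subtree k' t`. -/
def numInternal (k' : ℕ) (t : EdgeTree) : ℕ :=
  (internalNodes t ∩ subtree k' t).card

end EdgeTree

/-- `X` is a (possibly time-inhomogeneous) Markov chain in the countable discrete space `S`, with
initial state `x₀` and with transition probability `p n x y` from `x` at time `n` to `y` at time
`n + 1`. -/
structure IsMarkovChain {Ω S : Type*} [MeasurableSpace Ω] [MeasurableSpace S] (P : Measure Ω)
    (X : ℕ → Ω → S) (x₀ : S) (p : ℕ → S → S → ℝ) : Prop where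
  measurable : ∀ n, Measurable (X n)
  initial : ∀ᵐ ω ∂P, X 0 ω = x₀
  transition : ∀ (n : ℕ) (x : ℕ → S) (y : S), P {ω | ∀ m ≤ n, X m ω = x m} ≠ 0 →
    (P[|{ω | ∀ m ≤ n, X m ω = x m}]).real {ω | X (n + 1) ω = y} = p n (x n) y

/-- `T` is distributed as the growing sequence `(T_n(k), n ≥ 0)` of `k`-ary trees: it starts from the
tree with one edge and, at each step, given the past, an edge of the current tree is chosen uniformly
at random and `k - 1` new edges are grafted on its middle. -/
def IsTreeGrowth {Ω : Type*} [MeasurableSpace Ω] (P : Measure Ω) (k : ℕ)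
    (T : ℕ → Ω → EdgeTree) : Prop :=
  IsMarkovChain P T EdgeTree.single (fun _ => EdgeTree.growthProb k)

/-- Transition probabilities of the number of internal nodes in the subtree. -/
def upProb (k k' n i j : ℕ) : ℝ :=
  if j = i + 1 then ((k' : ℝ) * i + 1) / ((k : ℝ) * n + 1)
  else if j = i then 1 - ((k' : ℝ) * i + 1) / ((k : ℝ) * n + 1)
  else 0

/-- `ν` is the generalized Mittag-Leffler distribution with parameters `α ∈ (0, 1)` and `θ > -α`: the
probability measure on `[0, ∞)` characterized by its moments of all real orders `q ≥ 0`. -/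
structure IsGenMittagLeffler (α θ : ℝ) (ν : Measure ℝ) : Prop where
  isProbabilityMeasure : IsProbabilityMeasure ν
  nonneg : ∀ᵐ x ∂ν, 0 ≤ x
  integrable_rpow : ∀ q : ℝ, 0 ≤ q → Integrable (fun x => x ^ q) ν
  integral_rpow : ∀ q : ℝ, 0 ≤ q → ∫ x, x ^ q ∂ν =
    Real.Gamma (θ + 1) * Real.Gamma (θ / α + q + 1) /
      (Real.Gamma (θ / α + 1) * Real.Gamma (θ + q * α + 1))

end

/-!
The transitions of the pair (number of internal nodes, subtree) come from one observation about a
single graft. If the split edge is outside the subtree, the graft is invisible there; if it is in the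
subtree, the subtree undergoes a graft of `k' - 1` edges at the same edge, and gains one internal
node (`EdgeTree.card_filter_graft`). A subtree with `i` internal nodes has `k' i + 1` edges and the
whole tree has `k n + 1`, so the number of internal nodes is a Markov chain `I` with the announced
transitions, and when it increases, the new subtree is drawn by a uniform graft.

The sequence of subtrees indexed by the number of internal nodes is `EdgeTree.skeleton`. The
probability that `I` follows a given trajectory up to time `n` and that the skeleton follows given
trees `t 0, …, t j` is the product of the probability of the former event and of the weight of
`t 0, …, t j` for a growing sequence of `k'`-ary trees. For `j ≤ I n` this is an induction on the
time (`IsTreeGrowth.real_joint_path`, `IsTreeGrowth.real_joint_path_of_le`); since `I` tends almost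
surely to infinity, the restriction on `j` can be dropped
(`IsTreeGrowth.real_numInternal_inter_skeleton`). The law of the skeleton and its independence from
`I` follow, all the spaces being countable.

For the limit, put `a = 1/k'` and `b = 1/k`. For each `q > -a` the process
`Γ(I n + a + q) / Γ(I n + a) · Γ(n + b) / Γ(n + b + q k'/k)` is a positive martingale
(`NodeChain.martingale_gammaMart`), with an explicit mean. Since `Γ(x + q) / Γ(x)` is equivalent to
`x ^ q`, a negative `q` shows that `I` tends to infinity, `q = 1` gives the almost sure convergence of
`I n / n ^ (k'/k)`, and for `q ≥ 0` the martingale converges to the `q`-th power of the limit. It is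
bounded in `L²`, by comparison with the martingale of parameter `2 q`, so that the moment of order
`q` of the limit is the mean of the martingale.
-/

/-! ### Grafting and the subtree -/

namespace EdgeTree

theorem mem_subtree {k' : ℕ} {t : EdgeTree} {v : List ℕ} :
    v ∈ subtree k' t ↔ v ∈ t ∧ ∀ i ∈ v, i ≤ k' := by
  simp [subtree]

theorem mem_internalNodes {t : EdgeTree} {v : List ℕ} :
    v ∈ internalNodes t ↔ v ∈ t ∧ ∃ u ∈ t, v <+: u ∧ v ≠ u := by
  simp [internalNodes]

/-- Membership in the grafted tree, the edges above `w` being written as `w ++ a`. -/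
theorem mem_graft {k : ℕ} {t : EdgeTree} {w v : List ℕ} :
    v ∈ graft k t w ↔ (v ∈ t ∧ ¬ w <+: v) ∨ v = w ∨
      (∃ a, w ++ a ∈ t ∧ v = w ++ 1 :: a) ∨ ∃ i, 2 ≤ i ∧ i ≤ k ∧ v = w ++ [i] := by
  simp only [graft, Finset.mem_union, Finset.mem_filter, Finset.mem_singleton, Finset.mem_image,
    Finset.mem_Icc]
  constructor
  · rintro (((h | h) | ⟨u, ⟨hu, ⟨a, rfl⟩⟩, rfl⟩) | ⟨i, hi, rfl⟩)
    · exact Or.inl h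
    · exact Or.inr (Or.inl h)
    · exact Or.inr (Or.inr (Or.inl ⟨a, hu, by simp⟩))
    · exact Or.inr (Or.inr (Or.inr ⟨i, hi.1, hi.2, rfl⟩))
  · rintro (h | h | ⟨a, ha, rfl⟩ | ⟨i, h2, hk, rfl⟩)
    · exact Or.inl (Or.inl (Or.inl h))
    · exact Or.inl (Or.inl (Or.inr h))
    · exact Or.inl (Or.inr ⟨w ++ a, ⟨ha, List.prefix_append _ _⟩, by simp⟩)
    · exact Or.inr ⟨i, ⟨h2, hk⟩, rfl⟩

/-- The lifting of the edges above `w` by one level is injective. -/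
theorem injOn_lift (w : List ℕ) :
    Set.InjOn (fun v : List ℕ => w ++ 1 :: v.drop w.length) {v | w <+: v} := by
  rintro _ ⟨a, rfl⟩ _ ⟨b, rfl⟩ h
  simpa using h

theorem card_graft {k : ℕ} (hk : 1 ≤ k) (t : EdgeTree) (w : List ℕ) :
    (graft k t w).card = t.card + k := by
  have hinj : ((t.filter (fun v => w <+: v)).image (fun v => w ++ 1 :: v.drop w.length)).card
      = (t.filter (fun v => w <+: v)).card :=
    Finset.card_image_of_injOn ((injOn_lift w).mono (by intro v; simp))
  have hinj' : ((Finset.Icc 2 k).image (fun i => w ++ [i])).card = k - 1 := by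
    rw [Finset.card_image_of_injective _ (by intro a b h; simpa using h)]
    simp
  have hsplit := Finset.card_filter_add_card_filter_not (s := t) (fun v => w <+: v)
  unfold graft
  rw [Finset.card_union_of_disjoint, Finset.card_union_of_disjoint, Finset.card_union_of_disjoint,
    hinj, hinj', Finset.card_singleton]
  · omega
  · simp
  · rw [Finset.disjoint_left]
    intro v hv hv'
    obtain ⟨u, -, rfl⟩ := Finset.mem_image.1 hv'
    simp at hv
  · rw [Finset.disjoint_left]
    intro v hv hv'
    obtain ⟨i, hi, rfl⟩ := Finset.mem_image.1 hv'
    have := (Finset.mem_Icc.1 hi).1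
    simp at hv
    omega

theorem subtree_graft_of_mem {k k' : ℕ} (h1 : 1 ≤ k') (hkk' : k' ≤ k) {t : EdgeTree} {w : List ℕ}
    (hw : w ∈ subtree k' t) : subtree k' (graft k t w) = graft k' (subtree k' t) w := by
  have hw' := (mem_subtree.1 hw).2
  ext v
  simp only [mem_subtree, mem_graft]
  constructor
  · rintro ⟨h | h | ⟨a, ha, rfl⟩ | ⟨i, h2, hk, rfl⟩, hv⟩
    · exact Or.inl ⟨⟨h.1, hv⟩, h.2⟩
    · exact Or.inr (Or.inl h)
    · refine Or.inr (Or.inr (Or.inl ⟨a, ⟨ha, fun i hi => hv i ?_⟩, rfl⟩))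
      simp only [List.mem_append, List.mem_cons] at hi ⊢
      tauto
    · exact Or.inr (Or.inr (Or.inr ⟨i, h2, hv i (by simp), rfl⟩))
  · rintro (h | rfl | ⟨a, ⟨ha, ha'⟩, rfl⟩ | ⟨i, h2, hk, rfl⟩)
    · exact ⟨Or.inl ⟨h.1.1, h.2⟩, h.1.2⟩
    · exact ⟨Or.inr (Or.inl rfl), hw'⟩
    · refine ⟨Or.inr (Or.inr (Or.inl ⟨a, ha, rfl⟩)), fun i hi => ?_⟩
      simp only [List.mem_append, List.mem_cons] at hi ha'
      rcases hi with hi | rfl | hi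
      · exact hw' i hi
      · exact h1
      · exact ha' i (Or.inr hi)
    · refine ⟨Or.inr (Or.inr (Or.inr ⟨i, h2, hk.trans hkk', rfl⟩)), fun j hj => ?_⟩
      simp only [List.mem_append, List.mem_singleton] at hj
      rcases hj with hj | rfl
      · exact hw' j hj
      · exact hk

/-- All that a graft changes lies above the split edge, so it is not seen by a subtree that does
not contain this edge. -/
theorem subtree_graft_of_not_mem {k k' : ℕ} {t : EdgeTree} {w : List ℕ} (hw : w ∈ t)
    (hw' : w ∉ subtree k' t) : subtree k' (graft k t w) = subtree k' t := by
  have hnot : ∀ v : List ℕ, (∀ i ∈ v, i ≤ k') → ¬ w <+: v := by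
    intro v hv hwv
    exact hw' (mem_subtree.2 ⟨hw, fun i hi => hv i (hwv.subset hi)⟩)
  ext v
  simp only [mem_subtree, mem_graft]
  constructor
  · rintro ⟨h | rfl | ⟨a, ha, rfl⟩ | ⟨i, h2, hk, rfl⟩, hv⟩
    · exact ⟨h.1, hv⟩
    · exact absurd (List.prefix_refl _) (hnot _ hv)
    · exact absurd (List.prefix_append _ _) (hnot _ hv)
    · exact absurd (List.prefix_append _ _) (hnot _ hv)
  · rintro ⟨h, hv⟩
    exact ⟨Or.inl ⟨h, hnot v hv⟩, hv⟩

/-- The internal nodes after a graft: the new vertex, and the former internal nodes, those above the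
split edge being lifted by one level. -/
theorem mem_internalNodes_graft {k : ℕ} (hk : 2 ≤ k) {t : EdgeTree} {w v : List ℕ} (hw : w ∈ t) :
    v ∈ internalNodes (graft k t w) ↔ (v ∈ internalNodes t ∧ ¬ w <+: v) ∨ v = w ∨
      ∃ a, w ++ a ∈ internalNodes t ∧ v = w ++ 1 :: a := by
  constructor
  · intro h
    obtain ⟨hv, u, hu, hvu, hne⟩ := mem_internalNodes.1 h
    rcases mem_graft.1 hv with ⟨hvt, hwv⟩ | rfl | ⟨a, ha, rfl⟩ | ⟨i, h2, -, rfl⟩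
    · left
      refine ⟨mem_internalNodes.2 ⟨hvt, ?_⟩, hwv⟩
      rcases mem_graft.1 hu with ⟨hut, -⟩ | hu'
      · exact ⟨u, hut, hvu, hne⟩
      · have hwu : w <+: u := by
          rcases hu' with rfl | ⟨a, -, rfl⟩ | ⟨i, -, -, rfl⟩ <;> simp
        refine ⟨w, hw, (List.prefix_or_prefix_of_prefix hvu hwu).resolve_right hwv, ?_⟩
        rintro rfl
        exact hwv (List.prefix_refl _)
    · exact Or.inr (Or.inl rfl)
    · right; right
      refine ⟨a, mem_internalNodes.2 ⟨ha, ?_⟩, rfl⟩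
      rcases mem_graft.1 hu with ⟨-, hwu⟩ | rfl | ⟨b, hb, rfl⟩ | ⟨i, h2, -, rfl⟩
      · exact absurd ((List.prefix_append _ _).trans hvu) hwu
      · have := hvu.length_le
        simp at this
      · refine ⟨w ++ b, hb, ?_, ?_⟩
        · simpa [List.prefix_append_right_inj] using hvu
        · rintro h
          apply hne
          simpa using h
      · rw [List.prefix_append_right_inj] at hvu
        simp at hvu
        omega
    · exfalso
      rcases mem_graft.1 hu with ⟨-, hwu⟩ | rfl | ⟨b, hb, rfl⟩ | ⟨j, -, -, rfl⟩
      · exact hwu ((List.prefix_append _ _).trans hvu)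
      · have := hvu.length_le
        simp at this
      · rw [List.prefix_append_right_inj] at hvu
        simp at hvu
        omega
      · rw [List.prefix_append_right_inj] at hvu
        simp at hvu
        exact hne (by rw [hvu])
  · rintro (⟨h, hwv⟩ | rfl | ⟨a, ha, rfl⟩)
    · obtain ⟨hvt, u, hu, hvu, hne⟩ := mem_internalNodes.1 h
      refine mem_internalNodes.2 ⟨mem_graft.2 (Or.inl ⟨hvt, hwv⟩), ?_⟩
      by_cases hwu : w <+: u
      · refine ⟨w, mem_graft.2 (Or.inr (Or.inl rfl)),
          (List.prefix_or_prefix_of_prefix hvu hwu).resolve_right hwv, ?_⟩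
        rintro rfl
        exact hwv (List.prefix_refl _)
      · exact ⟨u, mem_graft.2 (Or.inl ⟨hu, hwu⟩), hvu, hne⟩
    · refine mem_internalNodes.2 ⟨mem_graft.2 (Or.inr (Or.inl rfl)), v ++ [2], ?_, by simp, by simp⟩
      exact mem_graft.2 (Or.inr (Or.inr (Or.inr ⟨2, le_rfl, hk, rfl⟩)))
    · obtain ⟨hvt, u, hu, ⟨b, rfl⟩, hne⟩ := mem_internalNodes.1 ha
      refine mem_internalNodes.2 ⟨mem_graft.2 (Or.inr (Or.inr (Or.inl ⟨a, hvt, rfl⟩))),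
        w ++ 1 :: (a ++ b), mem_graft.2 (Or.inr (Or.inr (Or.inl ⟨a ++ b, ?_, rfl⟩))), ?_, ?_⟩
      · simpa using hu
      · simp [List.prefix_append_right_inj]
      · simpa using hne

theorem numInternal_eq (k' : ℕ) (t : EdgeTree) :
    numInternal k' t = ((internalNodes t).filter (fun v => ∀ i ∈ v, i ≤ k')).card := by
  unfold numInternal
  congr 1
  ext v
  simp only [Finset.mem_inter, mem_subtree, Finset.mem_filter, mem_internalNodes]
  tauto

theorem numInternal_graft_of_not_mem {k k' : ℕ} (hk : 2 ≤ k) {t : EdgeTree} {w : List ℕ}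
    (hw : w ∈ t) (hw' : w ∉ subtree k' t) : numInternal k' (graft k t w) = numInternal k' t := by
  have hnot : ∀ v : List ℕ, (∀ i ∈ v, i ≤ k') → ¬ w <+: v := by
    intro v hv hwv
    exact hw' (mem_subtree.2 ⟨hw, fun i hi => hv i (hwv.subset hi)⟩)
  rw [numInternal_eq, numInternal_eq]
  congr 1
  ext v
  simp only [Finset.mem_filter, mem_internalNodes_graft hk hw]
  constructor
  · rintro ⟨h | rfl | ⟨a, ha, rfl⟩, hv⟩
    · exact ⟨h.1, hv⟩
    · exact absurd (List.prefix_refl _) (hnot _ hv)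
    · exact absurd (List.prefix_append _ _) (hnot _ hv)
  · rintro ⟨h, hv⟩
    exact ⟨Or.inl ⟨h, hnot v hv⟩, hv⟩

theorem numInternal_graft_of_mem {k k' : ℕ} (hk : 2 ≤ k) (h1 : 1 ≤ k') {t : EdgeTree}
    {w : List ℕ} (hw : w ∈ subtree k' t) :
    numInternal k' (graft k t w) = numInternal k' t + 1 := by
  obtain ⟨hwt, hw'⟩ := mem_subtree.1 hw
  set s := (internalNodes t).filter (fun v => ∀ i ∈ v, i ≤ k') with hs
  have key : (internalNodes (graft k t w)).filter (fun v => ∀ i ∈ v, i ≤ k') =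
      insert w (s.filter (fun v => ¬ w <+: v) ∪
        (s.filter (fun v => w <+: v)).image (fun v => w ++ 1 :: v.drop w.length)) := by
    ext v
    simp only [Finset.mem_filter, mem_internalNodes_graft hk hwt, Finset.mem_insert,
      Finset.mem_union, Finset.mem_image, hs]
    constructor
    · rintro ⟨h | rfl | ⟨a, ha, rfl⟩, hv⟩
      · exact Or.inr (Or.inl ⟨⟨h.1, hv⟩, h.2⟩)
      · exact Or.inl rfl
      · refine Or.inr (Or.inr ⟨w ++ a, ⟨⟨ha, fun i hi => hv i ?_⟩, by simp⟩, by simp⟩)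
        simp only [List.mem_append, List.mem_cons] at hi ⊢
        tauto
    · rintro (rfl | ⟨⟨h, hv⟩, hwv⟩ | ⟨_, ⟨⟨h, hv⟩, ⟨a, rfl⟩⟩, rfl⟩)
      · exact ⟨Or.inr (Or.inl rfl), hw'⟩
      · exact ⟨Or.inl ⟨h, hwv⟩, hv⟩
      · refine ⟨Or.inr (Or.inr ⟨a, h, by simp⟩), fun i hi => ?_⟩
        simp only [List.drop_left, List.mem_append, List.mem_cons] at hi hv
        rcases hi with hi | rfl | hi
        · exact hw' i hi
        · exact h1
        · exact hv i (Or.inr hi)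
  rw [numInternal_eq, key, numInternal_eq, ← hs, Finset.card_insert_of_notMem,
    Finset.card_union_of_disjoint, Finset.card_image_of_injOn,
    ← Finset.card_filter_add_card_filter_not (s := s) (fun v => w <+: v), add_comm (Finset.card _)]
  · exact (injOn_lift w).mono (by intro v; simp)
  · rw [Finset.disjoint_left]
    intro v hv hv'
    obtain ⟨u, -, rfl⟩ := Finset.mem_image.1 hv'
    simp at hv
  · simp

theorem subtree_single (k' : ℕ) : subtree k' single = single := by
  simp [subtree, single]

theorem numInternal_single (k' : ℕ) : numInternal k' single = 0 := by
  simp [numInternal, internalNodes, single]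

theorem card_single : single.card = 1 := rfl

/-! ### Trees obtained by successive grafts -/

/-- The trees `t 0, t 1, …` are obtained from the tree with one edge by successive grafts of `k - 1`
edges. -/
structure IsGrowthPath (k : ℕ) (t : ℕ → EdgeTree) : Prop where
  zero : t 0 = single
  succ : ∀ n, ∃ w ∈ t n, t (n + 1) = graft k (t n) w

namespace IsGrowthPath

variable {k k' : ℕ} {t : ℕ → EdgeTree}

theorem card (h : IsGrowthPath k t) (hk : 1 ≤ k) (n : ℕ) : (t n).card = k * n + 1 := by
  induction n with
  | zero => simp [h.zero, card_single]
  | succ n ih =>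
    obtain ⟨w, -, hw⟩ := h.succ n
    rw [hw, card_graft hk, ih]
    ring

/-- At each step, either the subtree is unchanged, or it undergoes a graft and gains one internal
node. -/
theorem step (h : IsGrowthPath k t) (hk' : 1 ≤ k') (hkk' : k' < k) (n : ℕ) :
    (subtree k' (t (n + 1)) = subtree k' (t n) ∧
      numInternal k' (t (n + 1)) = numInternal k' (t n)) ∨
    ((∃ w ∈ subtree k' (t n), subtree k' (t (n + 1)) = graft k' (subtree k' (t n)) w) ∧
      numInternal k' (t (n + 1)) = numInternal k' (t n) + 1) := by
  obtain ⟨w, hw, hw'⟩ := h.succ n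
  rw [hw']
  by_cases hmem : w ∈ subtree k' (t n)
  · exact Or.inr ⟨⟨w, hmem, subtree_graft_of_mem hk' hkk'.le hmem⟩,
      numInternal_graft_of_mem (by omega) hk' hmem⟩
  · exact Or.inl ⟨subtree_graft_of_not_mem hw hmem,
      numInternal_graft_of_not_mem (by omega) hw hmem⟩

theorem card_subtree (h : IsGrowthPath k t) (hk' : 1 ≤ k') (hkk' : k' < k) (n : ℕ) :
    (subtree k' (t n)).card = k' * numInternal k' (t n) + 1 := by
  induction n with
  | zero => simp [h.zero, subtree_single, numInternal_single, card_single]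
  | succ n ih =>
    rcases h.step hk' hkk' n with ⟨h1, h2⟩ | ⟨⟨w, -, h1⟩, h2⟩
    · rw [h1, h2, ih]
    · rw [h1, h2, card_graft hk', ih]
      ring

theorem numInternal_mono (h : IsGrowthPath k t) (hk' : 1 ≤ k') (hkk' : k' < k) :
    Monotone (fun n => numInternal k' (t n)) :=
  monotone_nat_of_le_succ fun n => by
    rcases h.step hk' hkk' n with ⟨-, h2⟩ | ⟨-, h2⟩ <;> omega

/-- The subtree depends on the time only through its number of internal nodes. -/
theorem subtree_eq_of_numInternal_eq (h : IsGrowthPath k t) (hk' : 1 ≤ k') (hkk' : k' < k)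
    {m n : ℕ} (hmn : m ≤ n) (heq : numInternal k' (t m) = numInternal k' (t n)) :
    subtree k' (t m) = subtree k' (t n) := by
  induction n, hmn using Nat.le_induction with
  | base => rfl
  | succ n hmn ih =>
    have h1 := h.numInternal_mono hk' hkk' hmn
    simp only at h1
    rcases h.step hk' hkk' n with ⟨h2, h3⟩ | ⟨-, h3⟩
    · rw [h2, ih (by omega)]
    · omega

theorem exists_numInternal_eq (h : IsGrowthPath k t) (hk' : 1 ≤ k') (hkk' : k' < k) {n l : ℕ}
    (hl : l ≤ numInternal k' (t n)) : ∃ m ≤ n, numInternal k' (t m) = l := by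
  induction n with
  | zero =>
    refine ⟨0, le_rfl, ?_⟩
    rw [h.zero, numInternal_single] at hl ⊢
    omega
  | succ n ih =>
    by_cases hl' : l ≤ numInternal k' (t n)
    · obtain ⟨m, hm, h1⟩ := ih hl'
      exact ⟨m, by omega, h1⟩
    · refine ⟨n + 1, le_rfl, ?_⟩
      rcases h.step hk' hkk' n with ⟨-, h2⟩ | ⟨-, h2⟩ <;> omega

end IsGrowthPath

end EdgeTree

/-! ### Markov chains in a countable space -/

section PathSums

variable {Ω S : Type*} [MeasurableSpace Ω] {P : Measure Ω}

theorem measurableSet_path [MeasurableSpace S] [MeasurableSingletonClass S] {X : ℕ → Ω → S}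
    (hX : ∀ n, Measurable (X n)) (n : ℕ) (x : ℕ → S) :
    MeasurableSet {ω | ∀ m ≤ n, X m ω = x m} := by
  have : {ω | ∀ m ≤ n, X m ω = x m} = ⋂ m, ⋂ (_ : m ≤ n), X m ⁻¹' {x m} := by
    ext ω; simp
  rw [this]
  exact MeasurableSet.iInter fun m => MeasurableSet.iInter fun _ =>
    hX m (measurableSet_singleton _)

/-- A proportionality of measures which holds on the fibres of a map into a countable space holds on
the preimages of all sets. -/
theorem measure_preimage_inter_eq_mul {α : Type*} [MeasurableSpace α] [Countable α]
    [MeasurableSingletonClass α] {R : Ω → α} (hR : Measurable R) {E : Set Ω} (hE : MeasurableSet E)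
    (c : ENNReal) (B : Set α) (h : ∀ a ∈ B, P (R ⁻¹' {a} ∩ E) = c * P (R ⁻¹' {a})) :
    P (R ⁻¹' B ∩ E) = c * P (R ⁻¹' B) := by
  have hmeas : ∀ a, MeasurableSet (R ⁻¹' {a}) := fun a => hR (measurableSet_singleton a)
  have hB : R ⁻¹' B = ⋃ a ∈ B, R ⁻¹' {a} := by
    ext ω; simp
  have hdisj : ∀ a b : α, a ≠ b → Disjoint (R ⁻¹' {a}) (R ⁻¹' {b}) := fun a b hab =>
    Disjoint.preimage R (by simpa using hab)
  have hBE : R ⁻¹' B ∩ E = ⋃ a ∈ B, R ⁻¹' {a} ∩ E := by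
    rw [hB, Set.iUnion₂_inter]
  rw [hBE, measure_biUnion B.to_countable (fun a _ b _ hab =>
      (hdisj a b hab).mono Set.inter_subset_left Set.inter_subset_left)
      (fun a _ => (hmeas a).inter hE), hB,
    measure_biUnion B.to_countable (fun a _ b _ hab => hdisj a b hab) (fun a _ => hmeas a),
    ← ENNReal.tsum_mul_left]
  exact tsum_congr fun a => h a a.2

/-- A proportionality of measures which holds on the events that prescribe the trajectory up to time
`n` holds on all events determined by the trajectory up to time `n`. -/
theorem measure_paths_inter_eq_mul [MeasurableSpace S] [Countable S] [MeasurableSingletonClass S]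
    {X : ℕ → Ω → S} (hX : ∀ n, Measurable (X n)) (n : ℕ) {B : Set (ℕ → S)}
    (hB : ∀ x y : ℕ → S, (∀ m ≤ n, x m = y m) → x ∈ B → y ∈ B) {E : Set Ω} (hE : MeasurableSet E)
    (c : ENNReal) (h : ∀ x ∈ B, P ({ω | ∀ m ≤ n, X m ω = x m} ∩ E) =
      c * P {ω | ∀ m ≤ n, X m ω = x m}) :
    P ({ω | (fun m => X m ω) ∈ B} ∩ E) = c * P {ω | (fun m => X m ω) ∈ B} := by
  let R : Ω → (Fin (n + 1) → S) := fun ω m => X m ω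
  have hR : Measurable R := measurable_pi_lambda _ fun m => hX m
  -- a finite trajectory is prolonged by repeating its last value
  let ext (a : Fin (n + 1) → S) : ℕ → S := fun m => a ⟨min m n, by omega⟩
  have hext : ∀ (a : Fin (n + 1) → S) (ω : Ω), R ω = a ↔ ∀ m ≤ n, X m ω = ext a m := by
    intro a ω
    constructor
    · rintro rfl m hm
      simp [ext, R, hm]
    · intro hm
      funext m
      have h1 := hm m (by omega)
      have h2 : (⟨min m n, by omega⟩ : Fin (n + 1)) = m := by
        apply Fin.ext
        simp
        omega
      simpa only [ext, h2] using h1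
  have hset : {ω | (fun m => X m ω) ∈ B} = R ⁻¹' {a | ext a ∈ B} := by
    ext ω
    have := (hext (R ω) ω).1 rfl
    exact ⟨fun h => hB _ _ this h, fun h => hB _ _ (fun m hm => (this m hm).symm) h⟩
  rw [hset]
  refine measure_preimage_inter_eq_mul hR hE c _ fun a ha => ?_
  have : R ⁻¹' {a} = {ω | ∀ m ≤ n, X m ω = ext a m} := by
    ext ω
    exact hext a ω
  rw [this]
  exact h _ ha

theorem measureReal_paths_inter_eq_mul [IsFiniteMeasure P] [MeasurableSpace S] [Countable S]
    [MeasurableSingletonClass S] {X : ℕ → Ω → S} (hX : ∀ n, Measurable (X n)) (n : ℕ)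
    {B : Set (ℕ → S)} (hB : ∀ x y : ℕ → S, (∀ m ≤ n, x m = y m) → x ∈ B → y ∈ B)
    {E : Set Ω} (hE : MeasurableSet E) (c : ℝ)
    (h : ∀ x ∈ B, P.real ({ω | ∀ m ≤ n, X m ω = x m} ∩ E) =
      c * P.real {ω | ∀ m ≤ n, X m ω = x m}) :
    P.real ({ω | (fun m => X m ω) ∈ B} ∩ E) = c * P.real {ω | (fun m => X m ω) ∈ B} := by
  rcases lt_or_ge c 0 with hc | hc
  -- a negative factor is possible only if all the measures vanish
  · have hzero : P {ω | (fun m => X m ω) ∈ B} = 0 := by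
      have := measure_paths_inter_eq_mul hX n hB (P := P) MeasurableSet.univ 0 fun x hx => ?_
      · simpa using this
      · have h1 := h x hx
        have h2 : 0 ≤ P.real ({ω | ∀ m ≤ n, X m ω = x m} ∩ E) := measureReal_nonneg
        have h3 : 0 ≤ P.real {ω | ∀ m ≤ n, X m ω = x m} := measureReal_nonneg
        have h4 : P.real {ω | ∀ m ≤ n, X m ω = x m} = 0 := by nlinarith
        simpa [measureReal_eq_zero_iff] using h4
    have h2 : P ({ω | (fun m => X m ω) ∈ B} ∩ E) = 0 :=
      measure_mono_null Set.inter_subset_left hzero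
    rw [measureReal_def, measureReal_def, hzero, h2]
    simp
  · have := measure_paths_inter_eq_mul hX n hB hE (P := P) (ENNReal.ofReal c) fun x hx => ?_
    · rw [measureReal_def, this, ENNReal.toReal_mul, ENNReal.toReal_ofReal hc, measureReal_def]
    · rw [← ofReal_measureReal, h x hx, ENNReal.ofReal_mul hc, ofReal_measureReal]

end PathSums

theorem measureReal_cond_apply {Ω : Type*} [MeasurableSpace Ω] {P : Measure Ω} {A : Set Ω}
    (hA : MeasurableSet A) (B : Set Ω) : (P[|A]).real B = (P.real A)⁻¹ * P.real (A ∩ B) := by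
  rw [measureReal_def, cond_apply hA, ENNReal.toReal_mul, ENNReal.toReal_inv, measureReal_def,
    measureReal_def]

namespace IsMarkovChain

variable {Ω S : Type*} [MeasurableSpace Ω] [MeasurableSpace S] {P : Measure Ω}
  [IsProbabilityMeasure P] {X : ℕ → Ω → S} {x₀ : S} {p : ℕ → S → S → ℝ}

theorem real_path_inter [MeasurableSingletonClass S] (hX : IsMarkovChain P X x₀ p) (n : ℕ)
    (x : ℕ → S) (y : S) :
    P.real ({ω | ∀ m ≤ n, X m ω = x m} ∩ {ω | X (n + 1) ω = y}) =
      P.real {ω | ∀ m ≤ n, X m ω = x m} * p n (x n) y := by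
  by_cases h : P {ω | ∀ m ≤ n, X m ω = x m} = 0
  · rw [measureReal_def, measureReal_def, measure_mono_null Set.inter_subset_left h, h]
    simp
  · rw [← hX.transition n x y h, measureReal_cond_apply (measurableSet_path hX.measurable n x),
      ← mul_assoc, mul_inv_cancel₀, one_mul]
    rwa [Ne, measureReal_eq_zero_iff]

theorem of_real_path_inter [MeasurableSingletonClass S] (hmeas : ∀ n, Measurable (X n))
    (h0 : ∀ᵐ ω ∂P, X 0 ω = x₀)
    (h : ∀ (n : ℕ) (x : ℕ → S) y, P {ω | ∀ m ≤ n, X m ω = x m} ≠ 0 →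
      P.real ({ω | ∀ m ≤ n, X m ω = x m} ∩ {ω | X (n + 1) ω = y}) =
      P.real {ω | ∀ m ≤ n, X m ω = x m} * p n (x n) y) : IsMarkovChain P X x₀ p where
  measurable := hmeas
  initial := h0
  transition n x y hne := by
    rw [measureReal_cond_apply (measurableSet_path hmeas n x), h n x y hne, ← mul_assoc,
      inv_mul_cancel₀, one_mul]
    rwa [Ne, measureReal_eq_zero_iff]

/-- The probability that the next state belongs to `B`, when the transition probabilities have
finite support. -/
theorem real_path_inter_mem [Countable S] [MeasurableSingletonClass S]
    (hX : IsMarkovChain P X x₀ p) (n : ℕ) (x : ℕ → S) (F : Finset S)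
    (hF : ∀ y ∉ F, p n (x n) y = 0) (B : Set S) [DecidablePred (· ∈ B)] :
    P.real ({ω | ∀ m ≤ n, X m ω = x m} ∩ {ω | X (n + 1) ω ∈ B}) =
      P.real {ω | ∀ m ≤ n, X m ω = x m} * ∑ y ∈ F with y ∈ B, p n (x n) y := by
  set A := {ω | ∀ m ≤ n, X m ω = x m} with hA
  have hAm : MeasurableSet A := measurableSet_path hX.measurable n x
  have hnull : P (A ∩ {ω | X (n + 1) ω ∉ F}) = 0 := by
    have : A ∩ {ω | X (n + 1) ω ∉ F} ⊆ ⋃ y ∈ (↑F : Set S)ᶜ, A ∩ {ω | X (n + 1) ω = y} := by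
      rintro ω ⟨h1, h2⟩
      simp only [Set.mem_iUnion]
      exact ⟨X (n + 1) ω, by simpa using h2, h1, rfl⟩
    refine measure_mono_null this ((measure_biUnion_null_iff (Set.to_countable _)).2 fun y hy => ?_)
    rw [← measureReal_eq_zero_iff, hX.real_path_inter n x y, hF y (by simpa using hy), mul_zero]
  have hae : (A ∩ {ω | X (n + 1) ω ∈ B} : Set Ω) =ᵐ[P]
      (⋃ y ∈ F.filter (· ∈ B), A ∩ {ω | X (n + 1) ω = y} : Set Ω) := by
    have h1 : ∀ᵐ ω ∂P, ω ∉ A ∩ {ω | X (n + 1) ω ∉ F} := measure_eq_zero_iff_ae_notMem.1 hnull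
    filter_upwards [h1] with ω hω
    refine propext ?_
    change ω ∈ A ∩ {ω | X (n + 1) ω ∈ B} ↔ ω ∈ ⋃ y ∈ F.filter (· ∈ B), A ∩ {ω | X (n + 1) ω = y}
    simp only [Set.mem_inter_iff, Set.mem_ofPred_eq, not_and, not_not, Set.mem_iUnion,
      Finset.mem_filter, exists_prop] at hω ⊢
    constructor
    · rintro ⟨h2, h3⟩
      exact ⟨_, ⟨hω h2, h3⟩, h2, rfl⟩
    · rintro ⟨y, ⟨-, hy⟩, h2, rfl⟩
      exact ⟨h2, hy⟩
  rw [measureReal_congr hae, measureReal_biUnion_finset, Finset.mul_sum]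
  · exact Finset.sum_congr rfl fun y _ => hX.real_path_inter n x y
  · intro y _ z _ hyz
    refine Set.disjoint_left.2 ?_
    rintro ω ⟨-, h1⟩ ⟨-, h2⟩
    exact hyz (h1.symm.trans h2)
  · exact fun y _ => hAm.inter (hX.measurable (n + 1) (measurableSet_singleton y))

/-- Almost surely, the chain makes only transitions of nonzero probability. -/
theorem ae_transition_ne_zero [Countable S] [MeasurableSingletonClass S]
    (hX : IsMarkovChain P X x₀ p) : ∀ᵐ ω ∂P, ∀ n, p n (X n ω) (X (n + 1) ω) ≠ 0 := by
  rw [ae_all_iff]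
  intro n
  have hpair : ∀ a b : S, p n a b = 0 → ∀ᵐ ω ∂P, ¬ (X n ω = a ∧ X (n + 1) ω = b) := by
    intro a b hab
    have h := measure_paths_inter_eq_mul (P := P) hX.measurable n (B := {x | x n = a})
      (fun x y hxy hx => by simpa [← hxy n le_rfl] using hx)
      (hX.measurable (n + 1) (measurableSet_singleton b)) 0 fun x hx => by
        rw [zero_mul, ← measureReal_eq_zero_iff]
        have := hX.real_path_inter n x b
        rw [show x n = a from hx, hab, mul_zero] at this
        exact this
    rw [zero_mul] at h
    exact measure_eq_zero_iff_ae_notMem.1 h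
  have hall : ∀ᵐ ω ∂P, ∀ a b : S, p n a b = 0 → ¬ (X n ω = a ∧ X (n + 1) ω = b) := by
    simp_rw [ae_all_iff]
    exact hpair
  filter_upwards [hall] with ω hω h0
  exact hω _ _ h0 ⟨rfl, rfl⟩

/-- A function of a Markov chain is a Markov chain when its transition probabilities, given the past
of the original chain, depend only on its current value. -/
theorem comp_of_lumpable [Countable S] [MeasurableSingletonClass S] {S' : Type*}
    [MeasurableSpace S'] [MeasurableSingletonClass S'] (hX : IsMarkovChain P X x₀ p) (f : S → S')
    (q : ℕ → S' → S' → ℝ)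
    (h : ∀ (n : ℕ) (x : ℕ → S) y, P {ω | ∀ m ≤ n, X m ω = x m} ≠ 0 →
      P.real ({ω | ∀ m ≤ n, X m ω = x m} ∩ {ω | f (X (n + 1) ω) = y}) =
      P.real {ω | ∀ m ≤ n, X m ω = x m} * q n (f (x n)) y) :
    IsMarkovChain P (fun n ω => f (X n ω)) (f x₀) q := by
  have hf : Measurable f := measurable_of_countable f
  refine of_real_path_inter (fun n => hf.comp (hX.measurable n)) ?_ ?_
  · filter_upwards [hX.initial] with ω hω
    rw [hω]
  · intro n s y _
    rw [mul_comm]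
    refine measureReal_paths_inter_eq_mul hX.measurable n (B := {x | ∀ m ≤ n, f (x m) = s m})
      (fun x z hxz hx m hm => by rw [← hxz m hm]; exact hx m hm)
      (hf.comp (hX.measurable (n + 1)) (measurableSet_singleton y)) _ fun x hx => ?_
    by_cases h0 : P {ω | ∀ m ≤ n, X m ω = x m} = 0
    · rw [measureReal_def, measureReal_def, measure_mono_null Set.inter_subset_left h0, h0]
      simp
    · rw [mul_comm, ← hx n le_rfl]
      exact h n x y h0

end IsMarkovChain

/-! ### Transitions of the number of internal nodes and of the subtree -/

namespace EdgeTree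

open Classical in
/-- Among the edges of `t` on which to graft, those outside the subtree change neither the number of
internal nodes nor the subtree, and the others are the edges of the subtree. -/
theorem card_filter_graft {k k' : ℕ} (hk' : 1 ≤ k') (hkk' : k' < k) (t : EdgeTree)
    (Q : ℕ → EdgeTree → Prop) :
    (t.filter fun w => Q (numInternal k' (graft k t w)) (subtree k' (graft k t w))).card =
      (if Q (numInternal k' t) (subtree k' t) then t.card - (subtree k' t).card else 0) +
      ((subtree k' t).filter fun w =>
        Q (numInternal k' t + 1) (graft k' (subtree k' t) w)).card := by
  have hsub : subtree k' t ⊆ t := Finset.filter_subset _ _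
  rw [← Finset.card_filter_add_card_filter_not (fun w => w ∈ subtree k' t), add_comm]
  congr 1
  · rw [Finset.filter_filter]
    have : (t.filter fun w => Q (numInternal k' (graft k t w)) (subtree k' (graft k t w)) ∧
        w ∉ subtree k' t) =
        if Q (numInternal k' t) (subtree k' t) then t \ subtree k' t else ∅ := by
      ext w
      split_ifs with hQ
      · simp only [Finset.mem_filter, Finset.mem_sdiff]
        constructor
        · rintro ⟨h1, -, h2⟩
          exact ⟨h1, h2⟩
        · rintro ⟨h1, h2⟩
          rw [numInternal_graft_of_not_mem (by omega) h1 h2, subtree_graft_of_not_mem h1 h2]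
          exact ⟨h1, hQ, h2⟩
      · simp only [Finset.mem_filter, Finset.notMem_empty, iff_false]
        rintro ⟨h1, h3, h2⟩
        rw [numInternal_graft_of_not_mem (by omega) h1 h2, subtree_graft_of_not_mem h1 h2] at h3
        exact hQ h3
    rw [this]
    split_ifs
    · rw [Finset.card_sdiff_of_subset hsub]
    · rfl
  · congr 1
    ext w
    simp only [Finset.mem_filter]
    constructor
    · rintro ⟨⟨h1, h2⟩, h3⟩
      rw [numInternal_graft_of_mem (by omega) hk' h3, subtree_graft_of_mem hk' hkk'.le h3] at h2
      exact ⟨h3, h2⟩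
    · rintro ⟨h3, h2⟩
      rw [numInternal_graft_of_mem (by omega) hk' h3, subtree_graft_of_mem hk' hkk'.le h3]
      exact ⟨⟨hsub h3, h2⟩, h3⟩

end EdgeTree

open EdgeTree

namespace IsTreeGrowth

variable {Ω : Type*} [MeasurableSpace Ω] {P : Measure Ω} [IsProbabilityMeasure P]
  {k k' : ℕ} {T : ℕ → Ω → EdgeTree}

theorem ae_isGrowthPath (hT : IsTreeGrowth P k T) :
    ∀ᵐ ω ∂P, IsGrowthPath k (fun n => T n ω) := by
  filter_upwards [hT.initial, hT.ae_transition_ne_zero] with ω h0 h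
  refine ⟨h0, fun n => ?_⟩
  have h1 := h n
  by_contra! hne
  apply h1
  rw [growthProb, Finset.filter_false_of_mem fun w hw => (hne w hw).symm]
  simp

open Classical in
theorem real_path_inter_mem (hT : IsTreeGrowth P k T) (n : ℕ) (x : ℕ → EdgeTree)
    (B : Set EdgeTree) :
    P.real ({ω | ∀ m ≤ n, T m ω = x m} ∩ {ω | T (n + 1) ω ∈ B}) =
      P.real {ω | ∀ m ≤ n, T m ω = x m} *
        (((x n).filter fun w => graft k (x n) w ∈ B).card / (x n).card) := by
  rw [IsMarkovChain.real_path_inter_mem hT n x ((x n).image (graft k (x n))) _ B]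
  · congr 1
    rw [Finset.card_eq_sum_card_fiberwise (f := graft k (x n))
      (t := ((x n).image (graft k (x n))).filter (· ∈ B)), Nat.cast_sum, Finset.sum_div]
    · refine Finset.sum_congr rfl fun y hy => ?_
      rw [growthProb, Finset.filter_filter]
      congr 3
      ext w
      simp only [Finset.mem_filter]
      constructor
      · rintro ⟨h1, rfl⟩
        exact ⟨h1, (Finset.mem_filter.1 hy).2, rfl⟩
      · rintro ⟨h1, -, h2⟩
        exact ⟨h1, h2⟩
    · intro w hw
      simp only [Finset.coe_filter, Set.mem_ofPred_eq] at hw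
      simp only [Finset.coe_filter, Set.mem_ofPred_eq, Finset.mem_image]
      exact ⟨⟨w, hw.1, rfl⟩, hw.2⟩
  · intro y hy
    rw [growthProb, Finset.filter_false_of_mem fun w hw h =>
      hy (Finset.mem_image.2 ⟨w, hw, h⟩)]
    simp

theorem card_of_measure_path_ne_zero (hT : IsTreeGrowth P k T) (hk' : 1 ≤ k') (hkk' : k' < k)
    {n : ℕ} {x : ℕ → EdgeTree} (hx : P {ω | ∀ m ≤ n, T m ω = x m} ≠ 0) :
    (x n).card = k * n + 1 ∧ (subtree k' (x n)).card = k' * numInternal k' (x n) + 1 := by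
  obtain ⟨ω, hω, hpath⟩ : ∃ ω ∈ {ω | ∀ m ≤ n, T m ω = x m}, IsGrowthPath k (fun n => T n ω) :=
    Filter.Frequently.exists (f := ae P) fun h => hx <| measure_eq_zero_iff_ae_notMem.2 <| by
      filter_upwards [hT.ae_isGrowthPath, h] with ω h1 h2 h3
      exact h2 ⟨h3, h1⟩
  rw [← hω n le_rfl]
  exact ⟨hpath.card (by omega) n, hpath.card_subtree hk' hkk' n⟩

/-- The joint law of the next number of internal nodes and the next subtree, given the past. -/
theorem real_path_inter_joint (hT : IsTreeGrowth P k T) (hk' : 1 ≤ k') (hkk' : k' < k) {n : ℕ}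
    {x : ℕ → EdgeTree} (hx : P {ω | ∀ m ≤ n, T m ω = x m} ≠ 0) (Q : ℕ → EdgeTree → Prop)
    [DecidablePred fun w => Q (numInternal k' (x n) + 1) (graft k' (subtree k' (x n)) w)]
    [Decidable (Q (numInternal k' (x n)) (subtree k' (x n)))] :
    P.real ({ω | ∀ m ≤ n, T m ω = x m} ∩
        {ω | Q (numInternal k' (T (n + 1) ω)) (subtree k' (T (n + 1) ω))}) =
      P.real {ω | ∀ m ≤ n, T m ω = x m} *
        ((if Q (numInternal k' (x n)) (subtree k' (x n)) then
            1 - ((k' : ℝ) * numInternal k' (x n) + 1) / ((k : ℝ) * n + 1) else 0) +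
          ((subtree k' (x n)).filter fun w =>
            Q (numInternal k' (x n) + 1) (graft k' (subtree k' (x n)) w)).card /
              ((k : ℝ) * n + 1)) := by
  obtain ⟨hcard, hcard'⟩ := hT.card_of_measure_path_ne_zero hk' hkk' hx
  have hle : (subtree k' (x n)).card ≤ (x n).card := Finset.card_filter_le _ _
  have h := hT.real_path_inter_mem n x {t | Q (numInternal k' t) (subtree k' t)}
  simp only [Set.mem_ofPred_eq] at h
  rw [h, card_filter_graft hk' hkk', Nat.cast_add, add_div, hcard]
  congr 2
  · have hpos : (k : ℝ) * n + 1 ≠ 0 := by positivity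
    rw [hcard, hcard'] at hle
    split_ifs
    · rw [hcard', Nat.cast_sub hle]
      push_cast
      field_simp
    · simp
  · push_cast
    congr

theorem real_path_inter_numInternal (hT : IsTreeGrowth P k T) (hk' : 1 ≤ k') (hkk' : k' < k)
    (n : ℕ) (x : ℕ → EdgeTree) (j : ℕ) :
    P.real ({ω | ∀ m ≤ n, T m ω = x m} ∩ {ω | numInternal k' (T (n + 1) ω) = j}) =
      P.real {ω | ∀ m ≤ n, T m ω = x m} * upProb k k' n (numInternal k' (x n)) j := by
  classical
  by_cases hx : P {ω | ∀ m ≤ n, T m ω = x m} = 0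
  · rw [measureReal_def, measureReal_def, measure_mono_null Set.inter_subset_left hx, hx]
    simp
  rw [hT.real_path_inter_joint hk' hkk' hx (fun i _ => i = j)]
  congr 1
  obtain ⟨-, hcard⟩ := hT.card_of_measure_path_ne_zero hk' hkk' hx
  unfold upProb
  by_cases h1 : j = numInternal k' (x n) + 1
  · subst h1
    simp [hcard]
  · by_cases h2 : j = numInternal k' (x n)
    · subst h2
      simp
    · rw [if_neg h1, if_neg h2, if_neg (Ne.symm h2), Finset.filter_false_of_mem]
      · simp
      · exact fun _ _ h => h1 h.symm

theorem isMarkovChain_numInternal (hT : IsTreeGrowth P k T) (hk' : 1 ≤ k') (hkk' : k' < k) :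
    IsMarkovChain P (fun n ω => numInternal k' (T n ω)) 0 (upProb k k') := by
  rw [← numInternal_single k']
  exact IsMarkovChain.comp_of_lumpable hT (numInternal k') _ fun n x y _ =>
    hT.real_path_inter_numInternal hk' hkk' n x y

end IsTreeGrowth

/-! ### The sequence of subtrees indexed by the number of internal nodes -/

theorem setOf_forall_le_succ {Ω : Type*} (p : ℕ → Ω → Prop) (n : ℕ) :
    {ω | ∀ m ≤ n + 1, p m ω} = {ω | ∀ m ≤ n, p m ω} ∩ {ω | p (n + 1) ω} := by
  ext ω
  constructor
  · intro h
    exact ⟨fun m hm => h m (by omega), h _ le_rfl⟩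
  · rintro ⟨h1, h2⟩ m hm
    rcases Nat.le_succ_iff.1 hm with h | rfl
    · exact h1 m h
    · exact h2

/-- The subtree at the first time when it has `i` internal nodes (at time `0` if there is no such
time, an event of probability `0`). -/
noncomputable def EdgeTree.skeleton {Ω : Type*} (k' : ℕ) (T : ℕ → Ω → EdgeTree) (i : ℕ) (ω : Ω) :
    EdgeTree :=
  subtree k' (T (sInf {n | numInternal k' (T n ω) = i}) ω)

/-- The probability that the first `j + 1` trees of a growing sequence of `k'`-ary trees are
`t 0, …, t j`. -/
noncomputable def EdgeTree.pathWeight (k' : ℕ) (t : ℕ → EdgeTree) (j : ℕ) : ℝ :=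
  (if t 0 = single then 1 else 0) * ∏ l ∈ Finset.range j, growthProb k' (t l) (t (l + 1))

theorem EdgeTree.pathWeight_succ (k' : ℕ) (t : ℕ → EdgeTree) (j : ℕ) :
    pathWeight k' t (j + 1) = pathWeight k' t j * growthProb k' (t j) (t (j + 1)) := by
  rw [pathWeight, pathWeight, Finset.prod_range_succ, mul_assoc]

theorem EdgeTree.IsGrowthPath.skeleton_numInternal {Ω : Type*} {k k' : ℕ} {T : ℕ → Ω → EdgeTree}
    {ω : Ω} (h : IsGrowthPath k (fun n => T n ω)) (hk' : 1 ≤ k') (hkk' : k' < k) (n : ℕ) :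
    skeleton k' T (numInternal k' (T n ω)) ω = subtree k' (T n ω) := by
  have hmem : n ∈ {m | numInternal k' (T m ω) = numInternal k' (T n ω)} := rfl
  exact h.subtree_eq_of_numInternal_eq hk' hkk' (Nat.sInf_le hmem) (Nat.sInf_mem ⟨n, hmem⟩)

namespace IsTreeGrowth

variable {Ω : Type*} [MeasurableSpace Ω] {P : Measure Ω}
  {k k' : ℕ} {T : ℕ → Ω → EdgeTree}

theorem measurable_numInternal (hT : IsTreeGrowth P k T) (n : ℕ) :
    Measurable fun ω => numInternal k' (T n ω) :=
  (measurable_of_countable (numInternal k')).comp (IsMarkovChain.measurable hT n)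

theorem measurable_skeleton (hT : IsTreeGrowth P k T) (i : ℕ) :
    Measurable (skeleton k' T i) := by
  have hset : ∀ n, MeasurableSet {ω | numInternal k' (T n ω) = i} := fun n =>
    hT.measurable_numInternal n (measurableSet_singleton i)
  have hτ : Measurable fun ω => sInf {n | numInternal k' (T n ω) = i} := by
    refine measurable_to_countable' fun n => ?_
    have : (fun ω => sInf {n | numInternal k' (T n ω) = i}) ⁻¹' {n} =
        ({ω | numInternal k' (T n ω) = i} ∩ ⋂ m < n, {ω | numInternal k' (T m ω) = i}ᶜ) ∪
        ({_ω | n = 0} ∩ ⋂ m, {ω | numInternal k' (T m ω) = i}ᶜ) := by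
      ext ω
      simp only [Set.mem_preimage, Set.mem_singleton_iff, Set.mem_union, Set.mem_inter_iff,
        Set.mem_ofPred_eq, Set.mem_iInter, Set.mem_compl_iff]
      constructor
      · intro h
        by_cases hne : {n | numInternal k' (T n ω) = i}.Nonempty
        · left
          subst h
          exact ⟨Nat.sInf_mem hne, fun m hm hm' =>
            Nat.notMem_of_lt_sInf (s := {n | numInternal k' (T n ω) = i}) hm hm'⟩
        · right
          rw [Set.not_nonempty_iff_eq_empty] at hne
          refine ⟨by rw [← h, hne, Nat.sInf_empty], fun m hm => ?_⟩
          have : m ∈ (∅ : Set ℕ) := hne ▸ hm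
          exact this
      · rintro (⟨h1, h2⟩ | ⟨rfl, h⟩)
        · refine le_antisymm (Nat.sInf_le h1) (not_lt.1 fun hlt => ?_)
          exact h2 _ hlt (Nat.sInf_mem (s := {n | numInternal k' (T n ω) = i}) ⟨n, h1⟩)
        · rw [Nat.sInf_eq_zero]
          right
          ext m
          simpa using h m
    rw [this]
    refine ((hset n).inter (.iInter fun m => .iInter fun _ => (hset m).compl)).union
      ((MeasurableSet.const _).inter (.iInter fun m => (hset m).compl))
  have hpair : Measurable fun q : Ω × ℕ => subtree k' (T q.2 q.1) :=
    measurable_from_prod_countable_left fun n =>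
      (measurable_of_countable (subtree k')).comp (IsMarkovChain.measurable hT n)
  exact hpair.comp (measurable_id.prodMk hτ)

variable [IsProbabilityMeasure P]

/-- Along a given trajectory of the number of internal nodes, each increase multiplies the
probability by the transition probability of a growing sequence of `k'`-ary trees. -/
theorem real_joint_path (hT : IsTreeGrowth P k T) (hk' : 1 ≤ k') (hkk' : k' < k) (n : ℕ)
    (i : ℕ → ℕ) (t : ℕ → EdgeTree) :
    P.real {ω | ∀ m ≤ n, numInternal k' (T m ω) = i m ∧ subtree k' (T m ω) = t (i m)} =
      P.real {ω | ∀ m ≤ n, numInternal k' (T m ω) = i m} * pathWeight k' t (i n) := by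
  classical
  have hI := hT.isMarkovChain_numInternal hk' hkk'
  induction n with
  | zero =>
    have hae : ∀ᵐ ω ∂P, numInternal k' (T 0 ω) = 0 ∧ subtree k' (T 0 ω) = single := by
      filter_upwards [hT.initial] with ω h
      rw [h]
      exact ⟨numInternal_single k', subtree_single k'⟩
    have hconst : ∀ (Q : ℕ → EdgeTree → Prop),
        P.real {ω | Q (numInternal k' (T 0 ω)) (subtree k' (T 0 ω))} =
          if Q 0 single then 1 else 0 := by
      intro Q
      split_ifs with hQ
      · rw [← probReal_univ (μ := P)]
        refine measureReal_congr ?_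
        filter_upwards [hae] with ω h
        refine propext ?_
        change Q _ _ ↔ True
        rw [h.1, h.2]
        simpa using hQ
      · rw [measureReal_eq_zero_iff]
        refine measure_eq_zero_iff_ae_notMem.2 ?_
        filter_upwards [hae] with ω h
        rwa [h.1, h.2]
    have h1 := hconst fun j y => j = i 0 ∧ y = t (i 0)
    have h2 := hconst fun j _ => j = i 0
    simp only [Nat.le_zero, forall_eq]
    rw [h1, h2]
    by_cases h0 : i 0 = 0
    · simp [h0, pathWeight, eq_comm]
    · simp [Ne.symm h0]
  | succ n ih =>
    rw [setOf_forall_le_succ, setOf_forall_le_succ, hI.real_path_inter]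
    have hstep := measureReal_paths_inter_eq_mul (P := P) (IsMarkovChain.measurable hT) n
      (B := {x | ∀ m ≤ n, numInternal k' (x m) = i m ∧ subtree k' (x m) = t (i m)})
      (fun x y hxy hx m hm => by rw [← hxy m hm]; exact hx m hm)
      (E := {ω | numInternal k' (T (n + 1) ω) = i (n + 1) ∧
        subtree k' (T (n + 1) ω) = t (i (n + 1))})
      (((measurable_of_countable fun x => (numInternal k' x, subtree k' x)).comp
        (IsMarkovChain.measurable hT (n + 1)))
          (measurableSet_singleton ((i (n + 1), t (i (n + 1))) : ℕ × EdgeTree)) |>.congr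
          (by ext ω; simp))
      (upProb k k' n (i n) (i (n + 1)) *
        if i (n + 1) = i n + 1 then growthProb k' (t (i n)) (t (i (n + 1))) else 1) ?_
    · refine hstep.trans ?_
      change _ * P.real {ω | ∀ m ≤ n, numInternal k' (T m ω) = i m ∧
        subtree k' (T m ω) = t (i m)} = _
      rw [ih]
      by_cases h1 : i (n + 1) = i n + 1
      · rw [if_pos h1, h1, pathWeight_succ]
        ring
      · by_cases h2 : i (n + 1) = i n
        · rw [if_neg h1, h2]
          ring
        · rw [upProb, if_neg h1, if_neg h2]
          ring
    · intro x hx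
      by_cases h0 : P {ω | ∀ m ≤ n, T m ω = x m} = 0
      · rw [measureReal_def, measureReal_def, measure_mono_null Set.inter_subset_left h0, h0]
        simp
      have hjoint := hT.real_path_inter_joint hk' hkk' h0
        (fun j y => j = i (n + 1) ∧ y = t (i (n + 1)))
      obtain ⟨hxi, hxt⟩ := hx n le_rfl
      obtain ⟨-, hcard⟩ := hT.card_of_measure_path_ne_zero hk' hkk' h0
      rw [hjoint, mul_comm]
      congr 1
      rw [hxi, hxt] at *
      unfold upProb
      by_cases h1 : i (n + 1) = i n + 1
      · have hpos : (k' : ℝ) * i n + 1 ≠ 0 := by positivity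
        have hne : i n ≠ i n + 1 := by omega
        rw [if_pos h1, if_pos h1, h1, growthProb, hcard]
        simp only [hne, false_and, if_false, true_and]
        push_cast
        field_simp
        simp
      · rw [if_neg h1, if_neg h1, Finset.filter_false_of_mem fun _ _ h => h1 h.1.symm]
        by_cases h2 : i (n + 1) = i n
        · simp [h2]
        · simp [h2, Ne.symm h2]

/-- After time `m`, the number of internal nodes evolves independently of the subtrees that
appeared before. -/
theorem real_joint_path_of_le (hT : IsTreeGrowth P k T) (hk' : 1 ≤ k') (hkk' : k' < k) {m n : ℕ}
    (hmn : m ≤ n) (i : ℕ → ℕ) (t : ℕ → EdgeTree) :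
    P.real ({ω | ∀ l ≤ n, numInternal k' (T l ω) = i l} ∩
        {ω | ∀ l ≤ m, subtree k' (T l ω) = t (i l)}) =
      P.real {ω | ∀ l ≤ n, numInternal k' (T l ω) = i l} * pathWeight k' t (i m) := by
  induction n, hmn using Nat.le_induction with
  | base =>
    rw [← hT.real_joint_path hk' hkk']
    congr 1
    ext ω
    simp only [Set.mem_inter_iff, Set.mem_ofPred_eq]
    exact ⟨fun h l hl => ⟨h.1 l hl, h.2 l hl⟩,
      fun h => ⟨fun l hl => (h l hl).1, fun l hl => (h l hl).2⟩⟩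
  | succ n hmn ih =>
    rw [setOf_forall_le_succ, (hT.isMarkovChain_numInternal hk' hkk').real_path_inter,
      Set.inter_right_comm]
    have hstep := measureReal_paths_inter_eq_mul (P := P) (IsMarkovChain.measurable hT) n
      (B := {x | (∀ l ≤ n, numInternal k' (x l) = i l) ∧ ∀ l ≤ m, subtree k' (x l) = t (i l)})
      (fun x y hxy hx => ⟨fun l hl => by rw [← hxy l hl]; exact hx.1 l hl,
        fun l hl => by rw [← hxy l (hl.trans hmn)]; exact hx.2 l hl⟩)
      (E := {ω | numInternal k' (T (n + 1) ω) = i (n + 1)})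
      (hT.measurable_numInternal (n + 1) (measurableSet_singleton _))
      (upProb k k' n (i n) (i (n + 1))) (fun x hx => by
        rw [hT.real_path_inter_numInternal hk' hkk', mul_comm, hx.1 n le_rfl])
    refine hstep.trans ?_
    change _ * P.real ({ω | ∀ l ≤ n, numInternal k' (T l ω) = i l} ∩
        {ω | ∀ l ≤ m, subtree k' (T l ω) = t (i l)}) = _
    rw [ih]
    ring

/-- If the number of internal nodes has reached `j` by time `n`, then the first `j + 1` trees of the
skeleton are the subtrees met up to the time when it equals `j`. -/
theorem real_numInternal_inter_skeleton_of_le (hT : IsTreeGrowth P k T) (hk' : 1 ≤ k')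
    (hkk' : k' < k) {n j : ℕ} (i : ℕ → ℕ) (hj : j ≤ i n) (t : ℕ → EdgeTree) :
    P.real ({ω | ∀ l ≤ n, numInternal k' (T l ω) = i l} ∩
        {ω | ∀ l ≤ j, skeleton k' T l ω = t l}) =
      P.real {ω | ∀ l ≤ n, numInternal k' (T l ω) = i l} * pathWeight k' t j := by
  by_cases h0 : P {ω | ∀ l ≤ n, numInternal k' (T l ω) = i l} = 0
  · rw [measureReal_def, measureReal_def, measure_mono_null Set.inter_subset_left h0, h0]
    simp
  obtain ⟨ω, hω, hpath⟩ : ∃ ω ∈ {ω | ∀ l ≤ n, numInternal k' (T l ω) = i l},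
      IsGrowthPath k (fun n => T n ω) :=
    Filter.Frequently.exists (f := ae P) fun h => h0 <| measure_eq_zero_iff_ae_notMem.2 <| by
      filter_upwards [hT.ae_isGrowthPath, h] with ω h1 h2 h3
      exact h2 ⟨h3, h1⟩
  obtain ⟨m, hm, hmj⟩ := hpath.exists_numInternal_eq hk' hkk' (n := n) (l := j) (by
    rw [hω n le_rfl]
    exact hj)
  have him : i m = j := by rw [← hω m hm, ← hmj]
  rw [← him, ← hT.real_joint_path_of_le hk' hkk' hm]
  refine measureReal_congr ?_
  filter_upwards [hT.ae_isGrowthPath] with ω h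
  refine propext ⟨fun ⟨h1, h2⟩ => ⟨h1, fun l hl => ?_⟩, fun ⟨h1, h2⟩ => ⟨h1, fun l hl => ?_⟩⟩
  · have h3 := h1 l (hl.trans hm)
    rw [← h.skeleton_numInternal hk' hkk', h3]
    refine h2 _ ?_
    rw [← h3, ← h1 m hm]
    exact h.numInternal_mono hk' hkk' hl
  · obtain ⟨p, hp, rfl⟩ := h.exists_numInternal_eq hk' hkk' (n := m) (l := l) (by
      rw [h1 m hm]
      exact hl)
    rw [h.skeleton_numInternal hk' hkk', h2 p hp, h1 p (hp.trans hm)]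

end IsTreeGrowth

/-! ### Law of the skeleton and independence -/

theorem tendsto_measureReal_inter_of_ae_eventually {Ω : Type*} [MeasurableSpace Ω] {P : Measure Ω}
    [IsFiniteMeasure P] {A : Set Ω} (hA : MeasurableSet A) {B : ℕ → Set Ω}
    (hB : ∀ n, MeasurableSet (B n)) (h : ∀ᵐ ω ∂P, ∀ᶠ n in atTop, ω ∈ B n) :
    Tendsto (fun n => P.real (A ∩ B n)) atTop (𝓝 (P.real A)) := by
  have := tendsto_measure_of_ae_tendsto_indicator_of_isFiniteMeasure (μ := P) atTop hA
    (fun n => hA.inter (hB n)) (by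
      filter_upwards [h] with ω hω
      filter_upwards [hω] with n hn
      exact ⟨fun h => h.1, fun h => ⟨h, hn⟩⟩)
  exact (ENNReal.tendsto_toReal (by finiteness)).comp this

namespace IsTreeGrowth

variable {Ω : Type*} [MeasurableSpace Ω] {P : Measure Ω} [IsProbabilityMeasure P]
  {k k' : ℕ} {T : ℕ → Ω → EdgeTree}

/-- The first `j + 1` trees of the skeleton are known once there are `j` internal nodes, hence
eventually; so the formula for large times holds at all times. -/
theorem real_numInternal_inter_skeleton (hT : IsTreeGrowth P k T) (hk' : 1 ≤ k') (hkk' : k' < k)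
    (hinf : ∀ᵐ ω ∂P, Tendsto (fun n => numInternal k' (T n ω)) atTop atTop) (n j : ℕ)
    (i : ℕ → ℕ) (t : ℕ → EdgeTree) :
    P.real ({ω | ∀ l ≤ n, numInternal k' (T l ω) = i l} ∩
        {ω | ∀ l ≤ j, skeleton k' T l ω = t l}) =
      pathWeight k' t j * P.real {ω | ∀ l ≤ n, numInternal k' (T l ω) = i l} := by
  have hI : ∀ n, Measurable fun ω => numInternal k' (T n ω) := hT.measurable_numInternal
  have hA := measurableSet_path hI n i
  have hS := measurableSet_path (hT.measurable_skeleton (k' := k')) j t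
  have hB : ∀ N, MeasurableSet {ω | j ≤ numInternal k' (T N ω)} := fun N =>
    hI N (MeasurableSet.of_discrete (s := Set.Ici j))
  have hev : ∀ᵐ ω ∂P, ∀ᶠ N in atTop, ω ∈ {ω | j ≤ numInternal k' (T N ω)} := by
    filter_upwards [hinf] with ω hω
    exact hω.eventually_ge_atTop j
  -- both sides are limits of the same expressions on the events `j ≤ I N`, as `N` tends to infinity
  refine tendsto_nhds_unique_of_eventuallyEq
    (tendsto_measureReal_inter_of_ae_eventually (hA.inter hS) hB hev)
    ((tendsto_measureReal_inter_of_ae_eventually hA hB hev).const_mul _) ?_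
  filter_upwards [eventually_ge_atTop n] with N hN
  have hstep := measureReal_paths_inter_eq_mul (P := P) hI N
    (B := {x | (∀ l ≤ n, x l = i l) ∧ j ≤ x N})
    (fun x y hxy hx => ⟨fun l hl => by rw [← hxy l (hl.trans hN)]; exact hx.1 l hl,
      by rw [← hxy N le_rfl]; exact hx.2⟩) hS (pathWeight k' t j) (fun x hx => by
      rw [hT.real_numInternal_inter_skeleton_of_le hk' hkk' x hx.2, mul_comm])
  rw [Set.inter_right_comm]
  exact hstep

theorem real_skeleton (hT : IsTreeGrowth P k T) (hk' : 1 ≤ k') (hkk' : k' < k)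
    (hinf : ∀ᵐ ω ∂P, Tendsto (fun n => numInternal k' (T n ω)) atTop atTop) (j : ℕ)
    (t : ℕ → EdgeTree) :
    P.real {ω | ∀ l ≤ j, skeleton k' T l ω = t l} = pathWeight k' t j := by
  have h := measureReal_paths_inter_eq_mul (P := P) (hT.measurable_numInternal (k' := k')) 0
    (B := Set.univ) (fun x y _ _ => Set.mem_univ y)
    (measurableSet_path (hT.measurable_skeleton (k' := k')) j t) (pathWeight k' t j)
    (fun x _ => hT.real_numInternal_inter_skeleton hk' hkk' hinf 0 j x t)
  simpa using h

theorem isTreeGrowth_skeleton (hT : IsTreeGrowth P k T) (hk' : 1 ≤ k') (hkk' : k' < k)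
    (hinf : ∀ᵐ ω ∂P, Tendsto (fun n => numInternal k' (T n ω)) atTop atTop) :
    IsTreeGrowth P k' (skeleton k' T) := by
  refine IsMarkovChain.of_real_path_inter hT.measurable_skeleton ?_ fun n x y _ => ?_
  · filter_upwards [hT.initial, hT.ae_isGrowthPath] with ω h0 h
    have h1 := h.skeleton_numInternal hk' hkk' 0
    rwa [h0, numInternal_single, subtree_single] at h1
  · have h1 := hT.real_skeleton hk' hkk' hinf (n + 1) (Function.update x (n + 1) y)
    rw [setOf_forall_le_succ, pathWeight_succ, ← hT.real_skeleton hk' hkk' hinf] at h1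
    have h2 : ∀ l ≤ n, Function.update x (n + 1) y l = x l := fun l hl =>
      Function.update_of_ne (by omega) _ _
    have h3 : {ω | ∀ l ≤ n, skeleton k' T l ω = Function.update x (n + 1) y l} =
        {ω | ∀ l ≤ n, skeleton k' T l ω = x l} := by
      ext ω
      exact forall₂_congr fun l hl => by rw [h2 l hl]
    rw [h3, h2 n le_rfl, Function.update_self] at h1
    exact h1

theorem indepFun_skeleton_numInternal (hT : IsTreeGrowth P k T) (hk' : 1 ≤ k') (hkk' : k' < k)
    (hinf : ∀ᵐ ω ∂P, Tendsto (fun n => numInternal k' (T n ω)) atTop atTop) :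
    IndepFun (fun ω n => skeleton k' T n ω) (fun ω n => numInternal k' (T n ω)) P := by
  have hI : ∀ n, Measurable fun ω => numInternal k' (T n ω) := hT.measurable_numInternal
  have hS : ∀ n, Measurable (skeleton k' T n) := hT.measurable_skeleton
  refine IndepFun.process_indepFun_process hS hI fun F G => ?_
  obtain ⟨j, hj⟩ := F.exists_le
  obtain ⟨n, hn⟩ := G.exists_le
  rw [indepFun_iff_measure_inter_preimage_eq_mul]
  intro A B _ hB
  -- first the event on the skeleton is a given trajectory, then an arbitrary one
  have hBm : MeasurableSet ((fun ω (l : G) => numInternal k' (T l ω)) ⁻¹' B) :=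
    (measurable_pi_lambda _ fun l : G => hI l) hB
  have hpath : ∀ t : ℕ → EdgeTree,
      P.real ({ω | ∀ l ≤ j, skeleton k' T l ω = t l} ∩
        (fun ω (l : G) => numInternal k' (T l ω)) ⁻¹' B) =
      P.real ((fun ω (l : G) => numInternal k' (T l ω)) ⁻¹' B) *
        P.real {ω | ∀ l ≤ j, skeleton k' T l ω = t l} := by
    intro t
    rw [hT.real_skeleton hk' hkk' hinf, mul_comm, Set.inter_comm]
    exact measureReal_paths_inter_eq_mul (P := P) hI n (B := {x | (fun l : G => x l) ∈ B})
      (fun x y hxy hx => by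
        have : (fun l : G => y l) = fun l : G => x l := funext fun l => (hxy l (hn l l.2)).symm
        simpa only [Set.mem_ofPred_eq, this] using hx)
      (measurableSet_path hS j t) (pathWeight k' t j)
      (fun x _ => hT.real_numInternal_inter_skeleton hk' hkk' hinf n j x t)
  have hall := measureReal_paths_inter_eq_mul (P := P) hS j
    (B := {x | (fun l : F => x l) ∈ A}) (fun x y hxy hx => by
        have : (fun l : F => y l) = fun l : F => x l := funext fun l => (hxy l (hj l l.2)).symm
        simpa only [Set.mem_ofPred_eq, this] using hx)
    hBm _ (fun x _ => hpath x)
  rw [mul_comm, ← ENNReal.toReal_eq_toReal_iff' (by finiteness) (by finiteness), ENNReal.toReal_mul]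
  exact hall

end IsTreeGrowth

/-! ### Ratios of Gamma functions -/

theorem Real.Gamma_add_nat_succ_eq_prod {s : ℝ} (hs : 0 < s) (n : ℕ) :
    Real.Gamma (s + (n + 1 : ℕ)) = Real.Gamma s * ∏ j ∈ Finset.range (n + 1), (s + j) := by
  induction n with
  | zero =>
    simp [Real.Gamma_add_one hs.ne', mul_comm]
  | succ n ih =>
    rw [Finset.prod_range_succ, ← mul_assoc, ← ih, mul_comm, ← Real.Gamma_add_one (by positivity)]
    congr 1
    push_cast
    ring

theorem Real.tendsto_rpow_mul_factorial_div_Gamma {s : ℝ} (hs : 0 < s) :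
    Tendsto (fun n : ℕ => (n : ℝ) ^ s * (n.factorial : ℝ) / Real.Gamma (s + (n + 1 : ℕ))) atTop
      (𝓝 1) := by
  have hΓ := Real.Gamma_pos_of_pos hs
  have h := (Real.GammaSeq_tendsto_Gamma s).div_const (Real.Gamma s)
  rw [div_self hΓ.ne'] at h
  refine h.congr fun n => ?_
  rw [Real.Gamma_add_nat_succ_eq_prod hs, Real.GammaSeq, div_div, mul_comm (Real.Gamma s)]

/-- `Γ(n + s + q) / Γ(n + s)` is equivalent to `n ^ q`. -/
theorem Real.tendsto_Gamma_add_div_Gamma {s q : ℝ} (hs : 0 < s) (hsq : 0 < s + q) :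
    Tendsto (fun n : ℕ => Real.Gamma (n + s + q) / Real.Gamma (n + s) / (n : ℝ) ^ q) atTop
      (𝓝 1) := by
  have h1 := (Real.tendsto_rpow_mul_factorial_div_Gamma hs).div
    (Real.tendsto_rpow_mul_factorial_div_Gamma hsq) one_ne_zero
  have hat : Tendsto (fun n : ℕ => (n : ℝ) + (s + q)) atTop atTop :=
    tendsto_atTop_add_const_right _ _ tendsto_natCast_atTop_atTop
  have h2 : Tendsto (fun n : ℕ => ((n : ℝ) + s) / (n + (s + q))) atTop (𝓝 1) := by
    have : Tendsto (fun n : ℕ => 1 - q / ((n : ℝ) + (s + q))) atTop (𝓝 (1 - 0)) :=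
      tendsto_const_nhds.sub (hat.const_div_atTop q)
    rw [sub_zero] at this
    refine this.congr fun n => ?_
    have : (n : ℝ) + (s + q) ≠ 0 := by positivity
    field_simp
    ring
  have h3 := h1.mul h2
  rw [div_one, one_mul] at h3
  refine h3.congr' ?_
  filter_upwards [eventually_gt_atTop 0] with n hn
  have hn' : (0 : ℝ) < n := by exact_mod_cast hn
  have e1 : Real.Gamma (s + (n + 1 : ℕ)) = (n + s) * Real.Gamma (n + s) := by
    rw [← Real.Gamma_add_one (by positivity)]
    congr 1
    push_cast
    ring
  have e2 : Real.Gamma (s + q + (n + 1 : ℕ)) = (n + (s + q)) * Real.Gamma (n + s + q) := by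
    rw [add_assoc (n : ℝ) s q, ← Real.Gamma_add_one (by positivity)]
    congr 1
    push_cast
    ring
  simp only [Pi.div_apply]
  rw [e1, e2, Real.rpow_add hn']
  have g1 : Real.Gamma (n + s) ≠ 0 := (Real.Gamma_pos_of_pos (by positivity)).ne'
  have g2 : Real.Gamma (n + s + q) ≠ 0 :=
    (Real.Gamma_pos_of_pos (by rw [add_assoc]; positivity)).ne'
  have g3 : (n : ℝ) ^ q ≠ 0 := (Real.rpow_pos_of_pos hn' _).ne'
  have g4 : (n : ℝ) ^ s ≠ 0 := (Real.rpow_pos_of_pos hn' _).ne'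
  have g5 : (n.factorial : ℝ) ≠ 0 := by exact_mod_cast n.factorial_ne_zero
  have g6 : (n : ℝ) + s ≠ 0 := by positivity
  have g7 : (n : ℝ) + (s + q) ≠ 0 := by positivity
  field_simp

/-- The ratio `Γ(n + s + q) / Γ(n + s)`, a substitute for `n ^ q`. -/
noncomputable def gammaRatio (s q : ℝ) (n : ℕ) : ℝ :=
  Real.Gamma (n + s + q) / Real.Gamma (n + s)

section gammaRatio

variable {s q : ℝ}

theorem gammaRatio_pos (hs : 0 < s) (hsq : 0 < s + q) (n : ℕ) : 0 < gammaRatio s q n :=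
  div_pos (Real.Gamma_pos_of_pos (by rw [add_assoc]; positivity))
    (Real.Gamma_pos_of_pos (by positivity))

theorem gammaRatio_succ (hs : 0 < s) (hsq : 0 < s + q) (n : ℕ) :
    gammaRatio s q (n + 1) = gammaRatio s q n * ((n + s + q) / (n + s)) := by
  have h1 : (n : ℝ) + s ≠ 0 := by positivity
  have h2 : (n : ℝ) + s + q ≠ 0 := by rw [add_assoc]; positivity
  unfold gammaRatio
  rw [show ((n + 1 : ℕ) : ℝ) + s + q = n + s + q + 1 by push_cast; ring,
    show ((n + 1 : ℕ) : ℝ) + s = n + s + 1 by push_cast; ring,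
    Real.Gamma_add_one h1, Real.Gamma_add_one h2]
  have := (Real.Gamma_pos_of_pos (show 0 < (n : ℝ) + s by positivity)).ne'
  field_simp

theorem gammaRatio_one (hs : 0 < s) (n : ℕ) : gammaRatio s 1 n = n + s := by
  have h1 : (n : ℝ) + s ≠ 0 := by positivity
  rw [gammaRatio, Real.Gamma_add_one h1, mul_div_assoc, div_self, mul_one]
  exact (Real.Gamma_pos_of_pos (by positivity)).ne'

theorem tendsto_gammaRatio_div_rpow (hs : 0 < s) (hsq : 0 < s + q) :
    Tendsto (fun n : ℕ => gammaRatio s q n / (n : ℝ) ^ q) atTop (𝓝 1) :=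
  Real.tendsto_Gamma_add_div_Gamma hs hsq

theorem tendsto_gammaRatio_sq_div (hs : 0 < s) (hsq : 0 < s + q) (hsq' : 0 < s + 2 * q) :
    Tendsto (fun n : ℕ => gammaRatio s q n ^ 2 / gammaRatio s (2 * q) n) atTop (𝓝 1) := by
  have h := ((tendsto_gammaRatio_div_rpow hs hsq).pow 2).div (tendsto_gammaRatio_div_rpow hs hsq')
    one_ne_zero
  rw [one_pow, div_one] at h
  refine h.congr' ?_
  filter_upwards [eventually_gt_atTop 0] with n hn
  have hn' : (0 : ℝ) < n := by exact_mod_cast hn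
  have g1 := (gammaRatio_pos hs hsq' n).ne'
  have g3 : (n : ℝ) ^ q ≠ 0 := (Real.rpow_pos_of_pos hn' _).ne'
  simp only [Pi.div_apply]
  rw [mul_comm 2 q, Real.rpow_mul hn'.le, Real.rpow_two]
  rw [mul_comm] at g1
  field_simp

theorem exists_gammaRatio_sq_le (hs : 0 < s) (hsq : 0 < s + q) (hsq' : 0 < s + 2 * q) :
    ∃ C, 0 ≤ C ∧ ∀ n, gammaRatio s q n ^ 2 ≤ C * gammaRatio s (2 * q) n := by
  obtain ⟨C, hC⟩ := (tendsto_gammaRatio_sq_div hs hsq hsq').bddAbove_range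
  refine ⟨C, ?_, fun n => ?_⟩
  · exact (div_nonneg (sq_nonneg _) (gammaRatio_pos hs hsq' 0).le).trans (hC ⟨0, rfl⟩)
  · exact (div_le_iff₀ (gammaRatio_pos hs hsq' n)).1 (hC ⟨n, rfl⟩)

theorem exists_le_gammaRatio_sq (hs : 0 < s) (hsq : 0 < s + q) (hsq' : 0 < s + 2 * q) :
    ∃ C, 0 ≤ C ∧ ∀ n, gammaRatio s (2 * q) n ≤ C * gammaRatio s q n ^ 2 := by
  have h := (tendsto_gammaRatio_sq_div hs hsq hsq').inv₀ one_ne_zero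
  obtain ⟨C, hC⟩ := h.bddAbove_range
  have hpos : ∀ n, 0 < gammaRatio s q n ^ 2 := fun n => pow_pos (gammaRatio_pos hs hsq n) 2
  refine ⟨C, ?_, fun n => ?_⟩
  · exact (inv_nonneg.2 (div_nonneg (sq_nonneg _) (gammaRatio_pos hs hsq' 0).le)).trans
      (hC ⟨0, rfl⟩)
  · have := hC ⟨n, rfl⟩
    simp only [inv_div] at this
    exact (div_le_iff₀ (hpos n)).1 this

end gammaRatio

/-! ### Convergence of means under a bound on second moments -/

theorem integral_eq_of_tendsto_of_sq_le {Ω : Type*} [MeasurableSpace Ω] {P : Measure Ω}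
    [IsProbabilityMeasure P] {f : ℕ → Ω → ℝ} {g : Ω → ℝ} {c C : ℝ}
    (hf : ∀ n, Integrable (f n) P) (hf2 : ∀ n, Integrable (fun ω => f n ω ^ 2) P)
    (hpos : ∀ n ω, 0 ≤ f n ω) (hmean : ∀ n, ∫ ω, f n ω ∂P = c)
    (hC : ∀ n, ∫ ω, f n ω ^ 2 ∂P ≤ C)
    (hlim : ∀ᵐ ω ∂P, Tendsto (fun n => f n ω) atTop (𝓝 (g ω))) :
    Integrable g P ∧ ∫ ω, g ω ∂P = c := by
  have hg0 : 0 ≤ᵐ[P] g := by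
    filter_upwards [hlim] with ω h
    exact ge_of_tendsto' h fun n => hpos n ω
  have hgm : AEStronglyMeasurable g P :=
    aestronglyMeasurable_of_tendsto_ae atTop (fun n => (hf n).aestronglyMeasurable) hlim
  have hfat : ∫⁻ ω, ENNReal.ofReal (g ω) ∂P ≤ ENNReal.ofReal c := by
    calc ∫⁻ ω, ENNReal.ofReal (g ω) ∂P
        = ∫⁻ ω, liminf (fun n => ENNReal.ofReal (f n ω)) atTop ∂P := by
          refine lintegral_congr_ae ?_
          filter_upwards [hlim] with ω h
          exact ((ENNReal.continuous_ofReal.tendsto _).comp h).liminf_eq.symm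
      _ ≤ liminf (fun n => ∫⁻ ω, ENNReal.ofReal (f n ω) ∂P) atTop :=
          lintegral_liminf_le' fun n => (hf n).aestronglyMeasurable.aemeasurable.ennreal_ofReal
      _ = ENNReal.ofReal c := by
          have : ∀ n, ∫⁻ ω, ENNReal.ofReal (f n ω) ∂P = ENNReal.ofReal c := fun n => by
            rw [← hmean n, ofReal_integral_eq_lintegral_ofReal (hf n)
              (Eventually.of_forall (hpos n))]
          simp [this]
  have hgi : Integrable g P :=
    (lintegral_ofReal_ne_top_iff_integrable hgm hg0).1 (hfat.trans_lt ENNReal.ofReal_lt_top).ne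
  have hc : 0 ≤ c := hmean 0 ▸ integral_nonneg (hpos 0)
  refine ⟨hgi, le_antisymm ?_ ?_⟩
  · rwa [← ofReal_integral_eq_lintegral_ofReal hgi hg0, ENNReal.ofReal_le_ofReal_iff hc] at hfat
  · -- truncation at level `K` costs at most `C / K`
    have htrunc : ∀ K : ℝ, 0 < K → c ≤ ∫ ω, g ω ∂P + C / K := by
      intro K hK
      have hmin : Tendsto (fun n => ∫ ω, min (f n ω) K ∂P) atTop (𝓝 (∫ ω, min (g ω) K ∂P)) := by
        refine tendsto_integral_of_dominated_convergence (fun _ => K)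
          (fun n => ((hf n).inf (integrable_const K)).aestronglyMeasurable) (integrable_const K)
          (fun n => Eventually.of_forall fun ω => ?_) ?_
        · rw [Real.norm_of_nonneg (le_min (hpos n ω) hK.le)]
          exact min_le_right _ _
        · filter_upwards [hlim] with ω h
          exact h.min tendsto_const_nhds
      have hle : ∀ n, c - C / K ≤ ∫ ω, min (f n ω) K ∂P := by
        intro n
        have h1 : ∀ ω, f n ω - f n ω ^ 2 / K ≤ min (f n ω) K := by
          intro ω
          refine le_min ?_ ?_
          · have : 0 ≤ f n ω ^ 2 / K := by positivity
            linarith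
          · have : f n ω - f n ω ^ 2 / K - K = -((f n ω - K) ^ 2 + f n ω * K) / K := by
              field_simp
              ring
            have h2 : 0 ≤ ((f n ω - K) ^ 2 + f n ω * K) / K := by
              have := hpos n ω
              positivity
            rw [neg_div] at this
            linarith
        have h2 := integral_mono ((hf n).sub ((hf2 n).div_const K))
          ((hf n).inf (integrable_const K)) h1
        simp only [Pi.sub_apply] at h2
        rw [integral_sub (hf n) ((hf2 n).div_const K), hmean, integral_div] at h2
        refine le_trans ?_ h2
        have := div_le_div_of_nonneg_right (hC n) hK.le
        linarith
      have h3 : c - C / K ≤ ∫ ω, min (g ω) K ∂P := ge_of_tendsto' hmin hle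
      have h4 : ∫ ω, min (g ω) K ∂P ≤ ∫ ω, g ω ∂P :=
        integral_mono (hgi.inf (integrable_const K)) hgi fun ω => min_le_left _ _
      linarith
    have hlimK : Tendsto (fun K : ℝ => ∫ ω, g ω ∂P + C / K) atTop (𝓝 (∫ ω, g ω ∂P + 0)) :=
      tendsto_const_nhds.add (tendsto_id.const_div_atTop C)
    rw [add_zero] at hlimK
    exact ge_of_tendsto hlimK ((eventually_gt_atTop 0).mono htrunc)

/-! ### Martingales attached to the number of internal nodes -/

/-- A random variable which takes almost surely its values in a finite set has integrals given by
finite sums. -/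
theorem setIntegral_comp_eq_sum {Ω β : Type*} [MeasurableSpace Ω] {P : Measure Ω}
    [IsFiniteMeasure P] [MeasurableSpace β] [MeasurableSingletonClass β] {Y : Ω → β}
    (hY : Measurable Y) (F : Finset β) (hF : ∀ᵐ ω ∂P, Y ω ∈ F) (h : β → ℝ) (s : Set Ω) :
    IntegrableOn (fun ω => h (Y ω)) s P ∧
      ∫ ω in s, h (Y ω) ∂P = ∑ y ∈ F, h y * P.real (s ∩ {ω | Y ω = y}) := by
  classical
  have hset : ∀ y, MeasurableSet {ω | Y ω = y} := fun y => hY (measurableSet_singleton y)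
  have hae : (fun ω => h (Y ω)) =ᵐ[P.restrict s]
      fun ω => ∑ y ∈ F, {ω | Y ω = y}.indicator (fun _ => h y) ω := by
    filter_upwards [ae_restrict_of_ae hF] with ω hω
    simp [Set.indicator_apply, hω]
  have hint : ∀ y ∈ F, Integrable ({ω | Y ω = y}.indicator fun _ => h y) (P.restrict s) :=
    fun y _ => (integrable_const _).indicator (hset y)
  refine ⟨(integrable_finsetSum F hint).congr hae.symm, ?_⟩
  rw [integral_congr_ae hae, integral_finsetSum F hint]
  refine Finset.sum_congr rfl fun y _ => ?_
  rw [integral_indicator_const _ (hset y), measureReal_restrict_apply (hset y), smul_eq_mul,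
    mul_comm, Set.inter_comm]

/-- The natural filtration of a process. At time `n` it is the pullback of the product σ-algebra by
the trajectory up to time `n`, so that its events are determined by this trajectory. -/
def pathFiltration {Ω S : Type*} {m0 : MeasurableSpace Ω} [MeasurableSpace S] (X : ℕ → Ω → S)
    (hX : ∀ n, Measurable (X n)) : Filtration ℕ m0 where
  seq n := MeasurableSpace.comap (fun ω (m : Finset.Iic n) => X m ω) inferInstance
  mono' i j hij := by
    have : (fun ω (m : Finset.Iic i) => X m ω) =
        (fun (x : Finset.Iic j → S) (m : Finset.Iic i) =>
          x ⟨m, Finset.mem_Iic.2 ((Finset.mem_Iic.1 m.2).trans hij)⟩) ∘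
        fun ω (m : Finset.Iic j) => X m ω := rfl
    beta_reduce
    rw [this, ← MeasurableSpace.comap_comp]
    exact MeasurableSpace.comap_mono
      (measurable_pi_lambda _ fun _ => measurable_pi_apply _).comap_le
  le' n := (measurable_pi_lambda _ fun m : Finset.Iic n => hX m).comap_le

namespace NodeChain

variable {Ω : Type*} {k k' : ℕ} {I : ℕ → Ω → ℕ}

/-- The ratio `Γ(I n + 1/k' + q) / Γ(I n + 1/k')`, normalized so as to have a constant mean. -/
noncomputable def gammaMart (k k' : ℕ) (q : ℝ) (I : ℕ → Ω → ℕ) (n : ℕ) (ω : Ω) : ℝ :=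
  gammaRatio (1 / k') q (I n ω) / gammaRatio (1 / k) ((k' : ℝ) / k * q) n

theorem pos_of_neg_inv_lt (hk' : 1 ≤ k') (hk : 1 ≤ k) {q : ℝ} (hq : -(1 / (k' : ℝ)) < q) :
    0 < 1 / (k' : ℝ) + q ∧ 0 < 1 / (k : ℝ) + (k' : ℝ) / k * q := by
  have h1 : (0 : ℝ) < k' := by exact_mod_cast hk'
  have h2 : (0 : ℝ) < k := by exact_mod_cast hk
  refine ⟨by linarith, ?_⟩
  have : 1 / (k : ℝ) + (k' : ℝ) / k * q = (k' : ℝ) / k * (1 / k' + q) := by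
    field_simp
  rw [this]
  exact mul_pos (by positivity) (by linarith)

theorem gammaMart_pos (hk' : 1 ≤ k') (hk : 1 ≤ k) {q : ℝ} (hq : -(1 / (k' : ℝ)) < q) (n : ℕ)
    (ω : Ω) : 0 < gammaMart k k' q I n ω := by
  obtain ⟨h1, h2⟩ := pos_of_neg_inv_lt hk' hk hq
  exact div_pos (gammaRatio_pos (by positivity) h1 _) (gammaRatio_pos (by positivity) h2 _)

variable [MeasurableSpace Ω] {P : Measure Ω} [IsProbabilityMeasure P]

theorem ae_step (hI : IsMarkovChain P I 0 (upProb k k')) :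
    ∀ᵐ ω ∂P, I 0 ω = 0 ∧ ∀ n, I (n + 1) ω = I n ω ∨ I (n + 1) ω = I n ω + 1 := by
  filter_upwards [hI.initial, hI.ae_transition_ne_zero] with ω h0 h
  refine ⟨h0, fun n => ?_⟩
  have := h n
  unfold upProb at this
  by_contra! hne
  simp [hne.1, hne.2] at this

theorem ae_le (hI : IsMarkovChain P I 0 (upProb k k')) : ∀ᵐ ω ∂P, ∀ n, I n ω ≤ n := by
  filter_upwards [ae_step hI] with ω h n
  induction n with
  | zero => exact h.1.le
  | succ n ih => rcases h.2 n with h | h <;> omega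

theorem integrable_comp (hI : IsMarkovChain P I 0 (upProb k k')) (h : ℕ → ℝ) (n : ℕ) :
    Integrable (fun ω => h (I n ω)) P := by
  have := (setIntegral_comp_eq_sum (P := P) (hI.measurable n) (Finset.range (n + 1)) (by
    filter_upwards [ae_le hI] with ω hω
    exact Finset.mem_range_succ_iff.2 (hω n)) h Set.univ).1
  rwa [integrableOn_univ] at this

/-- The Markov property in integrated form. -/
theorem setIntegral_succ (hI : IsMarkovChain P I 0 (upProb k k')) (n : ℕ) (h : ℕ → ℝ)
    {B : Set (ℕ → ℕ)} (hB : ∀ x y : ℕ → ℕ, (∀ m ≤ n, x m = y m) → x ∈ B → y ∈ B) :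
    ∫ ω in {ω | (fun m => I m ω) ∈ B}, h (I (n + 1) ω) ∂P =
      ∫ ω in {ω | (fun m => I m ω) ∈ B},
        ((1 - ((k' : ℝ) * I n ω + 1) / ((k : ℝ) * n + 1)) * h (I n ω) +
          ((k' : ℝ) * I n ω + 1) / ((k : ℝ) * n + 1) * h (I n ω + 1)) ∂P := by
  set s := {ω | (fun m => I m ω) ∈ B} with hs
  have hmem : ∀ m, ∀ᵐ ω ∂P, I m ω ∈ Finset.range (m + 1) := by
    intro m
    filter_upwards [ae_le hI] with ω hω
    exact Finset.mem_range_succ_iff.2 (hω m)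
  have hstep : ∀ i y, P.real (s ∩ {ω | (I n ω, I (n + 1) ω) = (i, y)}) =
      upProb k k' n i y * P.real (s ∩ {ω | I n ω = i}) := by
    intro i y
    have := measureReal_paths_inter_eq_mul (P := P) hI.measurable n (B := B ∩ {x | x n = i})
      (fun x y hxy hx => ⟨hB x y hxy hx.1, by
        have h1 : x n = i := hx.2
        rw [Set.mem_ofPred_eq, ← hxy n le_rfl, h1]⟩)
      (hI.measurable (n + 1) (measurableSet_singleton y)) (upProb k k' n i y) (fun x hx => by
        have h1 : x n = i := hx.2
        rw [← h1, mul_comm]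
        exact hI.real_path_inter n x y)
    refine Eq.trans (congrArg _ ?_) this
    ext ω
    simp only [Set.mem_inter_iff, Set.mem_ofPred_eq, Prod.mk.injEq, hs, Set.mem_preimage,
      Set.mem_singleton_iff]
    tauto
  rw [(setIntegral_comp_eq_sum (P := P) ((hI.measurable n).prodMk (hI.measurable (n + 1)))
      (Finset.range (n + 1) ×ˢ Finset.range (n + 2)) (by
        filter_upwards [hmem n, hmem (n + 1)] with ω h1 h2
        exact Finset.mem_product.2 ⟨h1, h2⟩) (fun p => h p.2) s).2,
    (setIntegral_comp_eq_sum (P := P) (hI.measurable n) (Finset.range (n + 1)) (hmem n)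
      (fun i => (1 - ((k' : ℝ) * i + 1) / ((k : ℝ) * n + 1)) * h i +
          ((k' : ℝ) * i + 1) / ((k : ℝ) * n + 1) * h (i + 1)) s).2, Finset.sum_product]
  refine Finset.sum_congr rfl fun i hi => ?_
  simp only [hstep]
  simp only [← mul_assoc]
  rw [← Finset.sum_mul]
  congr 1
  have hi' : i < n + 1 := Finset.mem_range.1 hi
  have hsub : ({i, i + 1} : Finset ℕ) ⊆ Finset.range (n + 2) := by
    intro y hy
    simp only [Finset.mem_insert, Finset.mem_singleton] at hy
    rw [Finset.mem_range]
    omega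
  rw [← Finset.sum_subset hsub, Finset.sum_pair (by omega)]
  · simp [upProb]
    ring
  · intro y _ hy
    simp only [Finset.mem_insert, Finset.mem_singleton, not_or] at hy
    simp [upProb, hy.1, hy.2]

theorem setIntegral_gammaMart_succ (hI : IsMarkovChain P I 0 (upProb k k')) (hk' : 1 ≤ k')
    (hk : 1 ≤ k) {q : ℝ} (hq : -(1 / (k' : ℝ)) < q) (n : ℕ) {B : Set (ℕ → ℕ)}
    (hB : ∀ x y : ℕ → ℕ, (∀ m ≤ n, x m = y m) → x ∈ B → y ∈ B) :
    ∫ ω in {ω | (fun m => I m ω) ∈ B}, gammaMart k k' q I (n + 1) ω ∂P =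
      ∫ ω in {ω | (fun m => I m ω) ∈ B}, gammaMart k k' q I n ω ∂P := by
  obtain ⟨h1, h2⟩ := pos_of_neg_inv_lt hk' hk hq
  have h0 : (0 : ℝ) < k' := by exact_mod_cast hk'
  have h0' : (0 : ℝ) < k := by exact_mod_cast hk
  have ha : (0 : ℝ) < 1 / k' := by positivity
  have hb : (0 : ℝ) < 1 / k := by positivity
  refine (setIntegral_succ hI n (fun i => gammaRatio (1 / k') q i /
    gammaRatio (1 / k) ((k' : ℝ) / k * q) (n + 1)) hB).trans ?_
  congr 1
  funext ω
  rw [gammaMart, gammaRatio_succ ha h1, gammaRatio_succ hb h2]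
  have g1 := (gammaRatio_pos hb h2 n).ne'
  have g2 : (n : ℝ) + 1 / k + k' / k * q ≠ 0 := by rw [add_assoc]; positivity
  have g3 : (k : ℝ) * n + 1 ≠ 0 := by positivity
  have g4 : (k' : ℝ) * I n ω + 1 ≠ 0 := by positivity
  have e1 : (I n ω : ℝ) + 1 / k' + q = (k' * I n ω + 1 + k' * q) / k' := by field_simp
  have e2 : (I n ω : ℝ) + 1 / k' = (k' * I n ω + 1) / k' := by field_simp
  have e3 : (n : ℝ) + 1 / k + k' / k * q = (k * n + 1 + k' * q) / k := by field_simp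
  have e4 : (n : ℝ) + 1 / k = (k * n + 1) / k := by field_simp
  have g5 : (k : ℝ) * n + 1 + k' * q ≠ 0 := by
    intro h
    rw [e3, h] at g2
    simp at g2
  rw [e1, e2, e3, e4]
  field_simp
  ring

theorem integral_gammaMart (hI : IsMarkovChain P I 0 (upProb k k')) (hk' : 1 ≤ k')
    (hk : 1 ≤ k) {q : ℝ} (hq : -(1 / (k' : ℝ)) < q) (n : ℕ) :
    ∫ ω, gammaMart k k' q I n ω ∂P =
      gammaRatio (1 / k') q 0 / gammaRatio (1 / k) ((k' : ℝ) / k * q) 0 := by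
  induction n with
  | zero =>
    have : gammaMart k k' q I 0 =ᵐ[P] fun _ =>
        gammaRatio (1 / k') q 0 / gammaRatio (1 / k) ((k' : ℝ) / k * q) 0 := by
      filter_upwards [hI.initial] with ω h
      rw [gammaMart, h]
    rw [integral_congr_ae this]
    simp
  | succ n ih =>
    have := setIntegral_gammaMart_succ hI hk' hk hq n (B := Set.univ)
      (fun x y _ _ => Set.mem_univ y)
    simpa [ih] using this

theorem integrable_gammaMart (hI : IsMarkovChain P I 0 (upProb k k')) (q : ℝ) (n : ℕ) :
    Integrable (gammaMart k k' q I n) P :=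
  integrable_comp hI (fun i => gammaRatio (1 / k') q i /
    gammaRatio (1 / k) ((k' : ℝ) / k * q) n) n

theorem martingale_gammaMart (hI : IsMarkovChain P I 0 (upProb k k')) (hk' : 1 ≤ k')
    (hk : 1 ≤ k) {q : ℝ} (hq : -(1 / (k' : ℝ)) < q) :
    Martingale (gammaMart k k' q I) (pathFiltration I hI.measurable) P := by
  refine martingale_of_setIntegral_eq_succ (fun n => ?_) (integrable_gammaMart hI q) ?_
  · have h : Measurable[pathFiltration I hI.measurable n] (I n) :=
      (measurable_pi_apply (⟨n, Finset.mem_Iic.2 le_rfl⟩ : Finset.Iic n)).comp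
        (comap_measurable (fun ω (m : Finset.Iic n) => I m ω))
    exact ((measurable_of_countable fun i : ℕ => gammaRatio (1 / k') q i /
      gammaRatio (1 / k) ((k' : ℝ) / k * q) n).comp h).stronglyMeasurable
  · rintro n _ ⟨A, -, rfl⟩
    exact (setIntegral_gammaMart_succ hI hk' hk hq n
      (B := {x | (fun m : Finset.Iic n => x m) ∈ A}) fun x y hxy hx => by
        have : (fun m : Finset.Iic n => y m) = fun m : Finset.Iic n => x m :=
          funext fun m => (hxy m (Finset.mem_Iic.1 m.2)).symm
        simpa only [Set.mem_ofPred_eq, this] using hx).symm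

end NodeChain

/-! ### Convergence of the number of internal nodes -/

namespace NodeChain

variable {Ω : Type*} {k k' : ℕ} {I : ℕ → Ω → ℕ} [MeasurableSpace Ω] {P : Measure Ω}
  [IsProbabilityMeasure P]

/-- For negative `q`, the mean of `Γ(I n + 1/k' + q) / Γ(I n + 1/k')` tends to `0`, which forces the
number of internal nodes to tend to infinity. -/
theorem ae_tendsto_atTop (hI : IsMarkovChain P I 0 (upProb k k')) (hk' : 1 ≤ k') (hk : 1 ≤ k) :
    ∀ᵐ ω ∂P, Tendsto (fun n => I n ω) atTop atTop := by
  have h0 : (0 : ℝ) < k' := by exact_mod_cast hk'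
  have h0' : (0 : ℝ) < k := by exact_mod_cast hk
  -- any `q` in `(-1/k', 0)` would do
  set q : ℝ := -(1 / (2 * k')) with hq_def
  have hq0 : q < 0 := by rw [hq_def, neg_lt_zero]; positivity
  have hq : -(1 / (k' : ℝ)) < q := by
    rw [hq_def, neg_lt_neg_iff]
    exact one_div_lt_one_div_of_lt h0 (by linarith)
  obtain ⟨h1, h2⟩ := pos_of_neg_inv_lt hk' hk hq
  have ha : (0 : ℝ) < 1 / k' := by positivity
  have hb : (0 : ℝ) < 1 / k := by positivity
  have hαq : 0 < -((k' : ℝ) / k * q) := by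
    have : 0 < (k' : ℝ) / k := by positivity
    nlinarith
  -- the normalization tends to `0`
  have hnorm : Tendsto (gammaRatio (1 / k) ((k' : ℝ) / k * q)) atTop (𝓝 0) := by
    have h3 := (tendsto_gammaRatio_div_rpow hb h2).mul
      ((tendsto_rpow_neg_atTop hαq).comp tendsto_natCast_atTop_atTop)
    rw [mul_zero] at h3
    refine h3.congr' ?_
    filter_upwards [eventually_gt_atTop 0] with n hn
    have hn' : (0 : ℝ) < n := by exact_mod_cast hn
    have := (Real.rpow_pos_of_pos hn' ((k' : ℝ) / k * q)).ne'
    simp only [Function.comp_apply, neg_neg]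
    field_simp
  have hmean : ∀ n, ∫ ω, gammaRatio (1 / k') q (I n ω) ∂P =
      gammaRatio (1 / k') q 0 / gammaRatio (1 / k) ((k' : ℝ) / k * q) 0 *
        gammaRatio (1 / k) ((k' : ℝ) / k * q) n := by
    intro n
    have h3 := integral_gammaMart hI hk' hk hq n
    have h4 := (gammaRatio_pos hb h2 n).ne'
    unfold gammaMart at h3
    rw [integral_div] at h3
    rw [← h3, div_mul_cancel₀ _ h4]
  have hmean0 : Tendsto (fun n => ∫ ω, gammaRatio (1 / k') q (I n ω) ∂P) atTop (𝓝 0) := by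
    simp_rw [hmean]
    simpa using hnorm.const_mul _
  have hbdd : ∀ j : ℕ, ∀ᵐ ω ∂P, ∃ n, j < I n ω := by
    intro j
    -- the ratio is bounded below by its minimum, at `i₀`, as long as `I n ≤ j`
    obtain ⟨i₀, -, hi₀⟩ := Finset.exists_min_image (Finset.range (j + 1))
      (gammaRatio (1 / k') q) ⟨0, by simp⟩
    have hδ : 0 < gammaRatio (1 / k') q i₀ := gammaRatio_pos ha h1 i₀
    have hmarkov : ∀ n, gammaRatio (1 / k') q i₀ * P.real {ω | I n ω ≤ j} ≤
        ∫ ω, gammaRatio (1 / k') q (I n ω) ∂P := by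
      intro n
      refine le_trans ?_ (mul_meas_ge_le_integral_of_nonneg
        (Eventually.of_forall fun ω => (gammaRatio_pos ha h1 _).le)
        (integrable_comp hI _ n) (gammaRatio (1 / k') q i₀))
      refine mul_le_mul_of_nonneg_left (measureReal_mono ?_) hδ.le
      intro ω hω
      exact hi₀ _ (Finset.mem_range_succ_iff.2 hω)
    have hlim : Tendsto (fun n => gammaRatio (1 / k') q i₀ * P.real {ω | I n ω ≤ j}) atTop
        (𝓝 0) :=
      squeeze_zero (fun n => mul_nonneg hδ.le measureReal_nonneg) hmarkov hmean0
    have hle : gammaRatio (1 / k') q i₀ * P.real {ω | ∀ n, I n ω ≤ j} ≤ 0 :=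
      ge_of_tendsto' hlim fun n => mul_le_mul_of_nonneg_left
        (measureReal_mono fun ω hω => hω n) hδ.le
    have hzero : P.real {ω | ∀ n, I n ω ≤ j} = 0 :=
      le_antisymm (by nlinarith) measureReal_nonneg
    rw [measureReal_eq_zero_iff] at hzero
    filter_upwards [measure_eq_zero_iff_ae_notMem.1 hzero] with ω hω
    simpa using hω
  filter_upwards [ae_all_iff.2 hbdd, ae_step hI] with ω hω hstep
  refine tendsto_atTop_atTop_of_monotone (monotone_nat_of_le_succ fun n => ?_) fun j => ?_
  · rcases hstep.2 n with h | h <;> omega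
  · obtain ⟨n, hn⟩ := hω j
    exact ⟨n, hn.le⟩

/-- The martingale for `q = 1` is the number of internal nodes, up to a shift and a deterministic
normalization equivalent to `n ^ (k'/k)`. -/
theorem ae_exists_tendsto_div_rpow (hI : IsMarkovChain P I 0 (upProb k k')) (hk' : 1 ≤ k')
    (hk : 1 ≤ k) :
    ∀ᵐ ω ∂P, ∃ l : ℝ, Tendsto (fun n : ℕ => (I n ω : ℝ) / (n : ℝ) ^ ((k' : ℝ) / k)) atTop
      (𝓝 l) := by
  have h0 : (0 : ℝ) < k' := by exact_mod_cast hk'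
  have h0' : (0 : ℝ) < k := by exact_mod_cast hk
  have ha : (0 : ℝ) < 1 / k' := by positivity
  have hb : (0 : ℝ) < 1 / k := by positivity
  have hq : -(1 / (k' : ℝ)) < 1 := by linarith
  obtain ⟨-, h2⟩ := pos_of_neg_inv_lt hk' hk hq
  have hα : 0 < (k' : ℝ) / k := by positivity
  have hmart := martingale_gammaMart hI hk' hk hq
  set c := gammaRatio (1 / k') 1 0 / gammaRatio (1 / k) ((k' : ℝ) / k * 1) 0
  have hbound : ∀ n, eLpNorm (gammaMart k k' 1 I n) 1 P ≤ (c.toNNReal : ENNReal) := by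
    intro n
    rw [eLpNorm_one_eq_lintegral_enorm, ← ofReal_integral_norm_eq_lintegral_enorm
      (integrable_gammaMart hI 1 n)]
    refine ENNReal.ofReal_le_ofReal (le_of_eq ?_)
    exact (integral_congr_ae (Eventually.of_forall fun ω =>
      Real.norm_of_nonneg (gammaMart_pos hk' hk hq n ω).le)).trans
      (integral_gammaMart hI hk' hk hq n)
  filter_upwards [hmart.submartingale.ae_tendsto_limitProcess hbound] with ω hω
  have hden : Tendsto (fun n : ℕ => (1 / (k' : ℝ)) / (n : ℝ) ^ ((k' : ℝ) / k)) atTop (𝓝 0) :=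
    ((tendsto_rpow_atTop hα).comp tendsto_natCast_atTop_atTop).const_div_atTop _
  refine ⟨_, ((hω.mul (tendsto_gammaRatio_div_rpow hb h2)).sub hden).congr' ?_⟩
  filter_upwards with n
  have := (gammaRatio_pos hb h2 n).ne'
  simp only [gammaMart, gammaRatio_one ha]
  rw [mul_one] at this ⊢
  rw [div_mul_div_cancel₀ this]
  ring

/-- For `q ≥ 0`, the martingale of parameter `q` converges to the `q`-th power of the limit, and its
square is dominated by the martingale of parameter `2 q`, so that the means converge too. -/
theorem integral_rpow_limit (hI : IsMarkovChain P I 0 (upProb k k')) (hk' : 1 ≤ k')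
    (hk : 1 ≤ k) {M : Ω → ℝ}
    (hM : ∀ᵐ ω ∂P, Tendsto (fun n : ℕ => (I n ω : ℝ) / (n : ℝ) ^ ((k' : ℝ) / k)) atTop
      (𝓝 (M ω))) {q : ℝ} (hq : 0 ≤ q) :
    Integrable (fun ω => M ω ^ q) P ∧ ∫ ω, M ω ^ q ∂P =
      gammaRatio (1 / k') q 0 / gammaRatio (1 / k) ((k' : ℝ) / k * q) 0 := by
  have h0 : (0 : ℝ) < k' := by exact_mod_cast hk'
  have h0' : (0 : ℝ) < k := by exact_mod_cast hk
  have ha : (0 : ℝ) < 1 / k' := by positivity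
  have hb : (0 : ℝ) < 1 / k := by positivity
  have hq1 : -(1 / (k' : ℝ)) < q := by linarith
  have hq2 : -(1 / (k' : ℝ)) < 2 * q := by linarith
  obtain ⟨h1, h2⟩ := pos_of_neg_inv_lt hk' hk hq1
  obtain ⟨h1', h2'⟩ := pos_of_neg_inv_lt hk' hk hq2
  have hcomm : (k' : ℝ) / k * (2 * q) = 2 * ((k' : ℝ) / k * q) := by ring
  obtain ⟨C, hC0, hC⟩ := exists_gammaRatio_sq_le ha h1 h1'
  obtain ⟨D, hD0, hD⟩ := exists_le_gammaRatio_sq hb h2 (hcomm ▸ h2')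
  have hsq : ∀ n ω, gammaMart k k' q I n ω ^ 2 ≤ C * D * gammaMart k k' (2 * q) I n ω := by
    intro n ω
    have p1 := gammaRatio_pos ha h1 (I n ω)
    have p2 := gammaRatio_pos hb h2 n
    have p3 := gammaRatio_pos hb h2' n
    have p4 := gammaRatio_pos ha h1' (I n ω)
    unfold gammaMart
    rw [hcomm] at p3 ⊢
    rw [div_pow, ← mul_div_assoc, div_le_div_iff₀ (by positivity) p3]
    calc gammaRatio (1 / k') q (I n ω) ^ 2 * gammaRatio (1 / k) (2 * ((k' : ℝ) / k * q)) n
        ≤ (C * gammaRatio (1 / k') (2 * q) (I n ω)) *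
          (D * gammaRatio (1 / k) ((k' : ℝ) / k * q) n ^ 2) :=
          mul_le_mul (hC _) (hD _) p3.le (by positivity)
      _ = _ := by ring
  have hint2 : ∀ n, Integrable (fun ω => gammaMart k k' q I n ω ^ 2) P := fun n =>
    integrable_comp hI (fun i => (gammaRatio (1 / k') q i /
      gammaRatio (1 / k) ((k' : ℝ) / k * q) n) ^ 2) n
  refine integral_eq_of_tendsto_of_sq_le (integrable_gammaMart hI q) hint2
    (fun n ω => (gammaMart_pos hk' hk hq1 n ω).le) (integral_gammaMart hI hk' hk hq1)
    (C := C * D * (gammaRatio (1 / k') (2 * q) 0 /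
      gammaRatio (1 / k) ((k' : ℝ) / k * (2 * q)) 0)) (fun n => ?_) ?_
  · rw [← integral_gammaMart hI hk' hk hq2 n, ← integral_const_mul]
    exact integral_mono (hint2 n) ((integrable_gammaMart hI (2 * q) n).const_mul _) (hsq n)
  · filter_upwards [hM, ae_tendsto_atTop hI hk' hk] with ω hω hinf
    have l1 := (tendsto_gammaRatio_div_rpow ha h1).comp hinf
    have l2 := (Real.continuousAt_rpow_const (M ω) q (Or.inr hq)).tendsto.comp hω
    have l3 := (tendsto_gammaRatio_div_rpow hb h2).inv₀ one_ne_zero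
    have l := (l1.mul l2).mul l3
    rw [one_mul, inv_one, mul_one] at l
    refine l.congr' ?_
    filter_upwards [eventually_gt_atTop 0, hinf.eventually_gt_atTop 0] with n hn hIn
    have hn' : (0 : ℝ) < n := by exact_mod_cast hn
    have hIn' : (0 : ℝ) < I n ω := by exact_mod_cast hIn
    have g1 := (Real.rpow_pos_of_pos hn' ((k' : ℝ) / k * q)).ne'
    have g2 := (Real.rpow_pos_of_pos hIn' q).ne'
    have g3 := (gammaRatio_pos hb h2 n).ne'
    simp only [Function.comp_apply, gammaMart]
    rw [Real.div_rpow hIn'.le (by positivity), ← Real.rpow_mul hn'.le, inv_div]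
    field_simp

/-- The mean of the martingale of parameter `q`, in the usual form of the moments of the generalized
Mittag-Leffler distribution. -/
theorem gammaRatio_zero_div_gammaRatio_zero (hk' : 1 ≤ k') (hk : 1 ≤ k) {q : ℝ} (hq : 0 ≤ q) :
    gammaRatio (1 / k') q 0 / gammaRatio (1 / k) ((k' : ℝ) / k * q) 0 =
      Real.Gamma (1 / (k : ℝ) + 1) * Real.Gamma (1 / (k : ℝ) / ((k' : ℝ) / k) + q + 1) /
      (Real.Gamma (1 / (k : ℝ) / ((k' : ℝ) / k) + 1) *
        Real.Gamma (1 / (k : ℝ) + q * ((k' : ℝ) / k) + 1)) := by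
  have h0 : (0 : ℝ) < k' := by exact_mod_cast hk'
  have h0' : (0 : ℝ) < k := by exact_mod_cast hk
  have ha : (0 : ℝ) < 1 / k' := by positivity
  have hb : (0 : ℝ) < 1 / k := by positivity
  have hα : 0 < (k' : ℝ) / k := by positivity
  have e1 : 1 / (k : ℝ) / ((k' : ℝ) / k) = 1 / k' := by field_simp
  have hb' : 0 < 1 / (k : ℝ) + k' / k * q := by positivity
  have ha' : 0 < 1 / (k' : ℝ) + q := by positivity
  rw [e1, mul_comm q, Real.Gamma_add_one ha.ne', Real.Gamma_add_one hb.ne',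
    Real.Gamma_add_one ha'.ne', Real.Gamma_add_one hb'.ne']
  simp only [gammaRatio, Nat.cast_zero, zero_add]
  have g1 := (Real.Gamma_pos_of_pos ha).ne'
  have g2 := (Real.Gamma_pos_of_pos hb).ne'
  have g3 := (Real.Gamma_pos_of_pos ha').ne'
  have g4 := (Real.Gamma_pos_of_pos hb').ne'
  have e2 : 1 / (k : ℝ) + k' / k * q = k' / k * (1 / k' + q) := by field_simp
  generalize Real.Gamma (1 / (k' : ℝ)) = A at *
  generalize Real.Gamma (1 / (k : ℝ)) = B at *
  generalize Real.Gamma (1 / (k' : ℝ) + q) = C at *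
  generalize Real.Gamma (1 / (k : ℝ) + k' / k * q) = D at *
  rw [e2]
  generalize 1 / (k' : ℝ) + q = u at *
  have hu := ha'.ne'
  field_simp

theorem isGenMittagLeffler_map (hI : IsMarkovChain P I 0 (upProb k k')) (hk' : 1 ≤ k')
    (hk : 1 ≤ k) {M : Ω → ℝ} (hMm : Measurable M)
    (hM : ∀ᵐ ω ∂P, Tendsto (fun n : ℕ => (I n ω : ℝ) / (n : ℝ) ^ ((k' : ℝ) / k)) atTop
      (𝓝 (M ω))) : IsGenMittagLeffler ((k' : ℝ) / k) (1 / (k : ℝ)) (P.map M) where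
  isProbabilityMeasure := Measure.isProbabilityMeasure_map hMm.aemeasurable
  nonneg := by
    refine (ae_map_iff hMm.aemeasurable measurableSet_Ici).2 ?_
    filter_upwards [hM] with ω hω
    exact ge_of_tendsto' hω fun n => by positivity
  integrable_rpow q hq := by
    rw [integrable_map_measure (by fun_prop) hMm.aemeasurable]
    exact (integral_rpow_limit hI hk' hk hM hq).1
  integral_rpow q hq := by
    rw [integral_map hMm.aemeasurable (by fun_prop), (integral_rpow_limit hI hk' hk hM hq).2,
      gammaRatio_zero_div_gammaRatio_zero hk' hk hq]

end NodeChain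

theorem mainTheorem9 (k k' : ℕ) (hk' : 2 ≤ k') (hkk' : k' < k)
    {Ω : Type*} [MeasurableSpace Ω] (P : Measure Ω) [IsProbabilityMeasure P]
    (T : ℕ → Ω → EdgeTree) (hT : IsTreeGrowth P k T)
    (I : ℕ → Ω → ℕ) (hI : ∀ n ω, I n ω = EdgeTree.numInternal k' (T n ω)) :
    (∃ T' : ℕ → Ω → EdgeTree,
      IsTreeGrowth P k' T' ∧
      IndepFun (fun ω n => T' n ω) (fun ω n => I n ω) P ∧
      ∀ᵐ ω ∂P, ∀ n, EdgeTree.subtree k' (T n ω) = T' (I n ω) ω) ∧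
    IsMarkovChain P I 0 (upProb k k') ∧
    ∃ M : Ω → ℝ, Measurable M ∧
      IsGenMittagLeffler ((k' : ℝ) / k) (1 / (k : ℝ)) (P.map M) ∧
      ∀ᵐ ω ∂P, Tendsto (fun n : ℕ => (I n ω : ℝ) / (n : ℝ) ^ ((k' : ℝ) / k)) atTop (𝓝 (M ω)) := by
  obtain rfl : I = fun n ω => EdgeTree.numInternal k' (T n ω) :=
    funext fun n => funext fun ω => hI n ω
  have h1 : 1 ≤ k' := by omega
  have h2 : 1 ≤ k := by omega
  have hchain := hT.isMarkovChain_numInternal h1 hkk'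
  have hinf := NodeChain.ae_tendsto_atTop hchain h1 h2
  refine ⟨⟨EdgeTree.skeleton k' T, hT.isTreeGrowth_skeleton h1 hkk' hinf,
    hT.indepFun_skeleton_numInternal h1 hkk' hinf, ?_⟩, hchain, ?_⟩
  · filter_upwards [hT.ae_isGrowthPath] with ω hω n
    exact (hω.skeleton_numInternal h1 hkk' n).symm
  · obtain ⟨M, hMm, hM⟩ := measurable_limit_of_tendsto_metrizable_ae
      (fun n : ℕ => ((measurable_of_countable
        (fun i : ℕ => (i : ℝ) / (n : ℝ) ^ ((k' : ℝ) / k))).comp (hchain.measurable n)).aemeasurable)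
      (NodeChain.ae_exists_tendsto_div_rpow hchain h1 h2)
    exact ⟨M, hMm, NodeChain.isGenMittagLeffler_map hchain h1 h2 hMm hM, hM⟩
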